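/- Let $n,k\ge 0$ be integers, let $\varphi:\mathbb Z^k\to \mathrm{SL}(n,\mathbb Z)$ be an injective homomorphism such that every matrix in its image is semisimple (that is, diagonalizable over $\mathbb C$), and let $\Gamma=\mathbb Z^n\rtimes_\varphi\mathbb Z^k$, with multiplication $(u,v)(x,y)=(u+\varphi(v)x,\;v+y)$. Fix a finite generating set of $\Gamma$ and let $d_\Gamma$ be the corresponding word metric. Then there are constants $A,B>0$ such that for any two conjugate elements $(u,v),(w,z)$ of $\Gamma$ there is $(x,y)\in\Gamma$ with $(u,v)(x,y)=(x,y)(w,z)$ and such that: 1. if $k=1$, and every complex eigenvalue of modulus $1$ of every matrix in $\varphi(\mathbb Z)$ is a root of unity (for example, if all these matrices have only real eigenvalues, or if $\varphi(1)$ has no eigenvalue of modulus $1$), then $$d_\Gamma(1,(x,y))\le B\bigl(d_\Gamma(1,(u,v))+d_\Gamma(1,(w,z))\bigr);$$ 2. if $k>1$, then $$d_\Gamma(1,(x,y))\le A^{\,d_\Gamma(1,(u,v))+d_\Gamma(1,(w,z))}.$$ -/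

import Mathlib

/-- The action of `SL(n, ℤ)` by automorphisms on `ℤⁿ`, the latter written multiplicatively:
a matrix sends a column vector `x` to `A *ᵥ x`. -/
def slAction (n : ℕ) :
    Matrix.SpecialLinearGroup (Fin n) ℤ →* MulAut (Multiplicative (Fin n → ℤ)) :=
  MonoidHom.mk' (fun A => (Matrix.SpecialLinearGroup.toLin' A).toAddEquiv.toMultiplicative)
    (fun A B => by
      ext x
      simp [map_mul])

theorem slAction_apply (n : ℕ) (A : Matrix.SpecialLinearGroup (Fin n) ℤ) (x : Fin n → ℤ) :
    slAction n A (Multiplicative.ofAdd x) =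
      Multiplicative.ofAdd (Matrix.mulVec (A : Matrix (Fin n) (Fin n) ℤ) x) :=
  rfl

/-- The semidirect product `ℤⁿ ⋊_φ ℤᵏ` determined by a homomorphism `φ : ℤᵏ → SL(n, ℤ)`, with
multiplication `(u, v) (x, y) = (u + φ(v) x, v + y)`. -/
abbrev LatticeSemidirect {n k : ℕ}
    (φ : Multiplicative (Fin k → ℤ) →* Matrix.SpecialLinearGroup (Fin n) ℤ) : Type :=
  SemidirectProduct (Multiplicative (Fin n → ℤ)) (Multiplicative (Fin k → ℤ))
    ((slAction n).comp φ)

/-- The linear endomorphism of `ℂⁿ` given by an integer matrix of determinant one. -/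
noncomputable def complexEnd {n : ℕ} (A : Matrix.SpecialLinearGroup (Fin n) ℤ) :
    Module.End ℂ (Fin n → ℂ) :=
  Matrix.toLin' ((A : Matrix (Fin n) (Fin n) ℤ).map (Int.cast : ℤ → ℂ))

/-- A matrix in `SL(n, ℤ)` is semisimple if it is so as an endomorphism of `ℂⁿ` (equivalently,
it is diagonalizable over `ℂ`). -/
def IsSemisimpleSL {n : ℕ} (A : Matrix.SpecialLinearGroup (Fin n) ℤ) : Prop :=
  (complexEnd A).IsSemisimple

/-- Every complex eigenvalue of modulus one is a root of unity. -/
def UnimodularEigenvaluesTorsion {n : ℕ} (A : Matrix.SpecialLinearGroup (Fin n) ℤ) : Prop :=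
  ∀ μ : ℂ, (complexEnd A).HasEigenvalue μ → ‖μ‖ = 1 → ∃ m : ℕ, 0 < m ∧ μ ^ m = 1

/-- The word length of `g` with respect to `S`, that is, the distance `d(1, g)` in the word
metric: the least length of a word in the elements of `S` and their inverses with value `g`. It
is meaningful when `S` generates the group, since then such a word exists. -/
noncomputable def wordLength {G : Type*} [Group G] (S : Set G) (g : G) : ℕ :=
  sInf {m : ℕ | ∃ l : List G, l.length = m ∧ (∀ s ∈ l, s ∈ S ∨ s⁻¹ ∈ S) ∧ l.prod = g}

/-!
Two elements `(u, v)` and `(w, v)` are conjugate by `(x, y)` if and only if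
`(φ v - 1) x = φ y w - u`. The matrices `φ v` are jointly diagonalizable over `ℂ`
(`JointDiagonalization.nonempty`), so that in suitable coordinates `ℤᵏ` acts by characters `χ i`.
Two facts about integers control the solutions. First, the product of the nonzero eigenvalues of
`φ v - 1` is a nonzero integer, being up to sign the trailing coefficient of the characteristic
polynomial; hence none of these eigenvalues is very small. Secondly, this integer times the
projection to the kernel of `φ v - 1` is an integer matrix (`exists_kernel_projection`); hence the
component of `x` in the kernel can be made small by adding integer vectors of the kernel
(`exists_small_solution`). So an equation `(φ v - 1) x = b` that has an integer solution has one of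
polynomially bounded size.

*The exponential bound.* Let `L` be the sum of the lengths of the conjugate elements; all vectors
and matrices given by them are at most exponential in `L`. Walk from `0` to `y` along the lattice
points near a straight segment. The component of `φ (y') w` in the kernel of `φ v - 1` stays
exponentially bounded during the walk, because it is so at both ends and the logarithm of `‖χ i‖` is
linear (`exists_path`); the other components are made small modulo the image of `φ v - 1`
(`exists_small_representative`). This gives a chain of conjugations from `(u, v)` to `(w, v)`
through elements `(a, v)` with `a` exponentially bounded, each by an element of exponentially
bounded length. There are at most exponentially many such `a`, so a shortest chain has at most
exponentially many steps (`exists_conj_wordLength_le_of_chain`).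

*The linear bound.* Let `k = 1`, with generator `t`. An integer vector has word length linear in its
components on the unimodular eigenvectors of `φ t`, but logarithmic in the others
(`exists_wordLength_le_hyperbolic`), and conversely a word of length `L` has components of at most
these orders (`exists_coord_le_wordLength`). If `v ≠ 0`, multiplying the conjugator by powers of
`(u, v)` reduces `y` modulo `v`; the eigenvalues of `φ v - 1` different from zero are bounded below
independently of `v`, as the unimodular ones of `φ t` are roots of unity, and only finitely many
kernels of `φ v - 1` occur, so that a small solution `x` has the required components. If `v = 0`,
then `u = φ y w`. Halfway between `w` and `u` the non-unimodular component is at most of size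
`e ^ (C L - c |y|)`, while a fixed multiple of it is an integer vector; so either `|y|` is linearly
bounded in `L`, or this component vanishes and `y` can be reduced modulo the orders of the roots of
unity (`exists_le_or_forall_coord_eq_zero`).
-/

/-! ### Word length -/

section WordLength

variable {G : Type*} [Group G] {S : Set G}

theorem wordLength_le_length {l : List G} (hl : ∀ s ∈ l, s ∈ S ∨ s⁻¹ ∈ S) :
    wordLength S l.prod ≤ l.length :=
  Nat.sInf_le ⟨l, rfl, hl, rfl⟩

theorem exists_list_wordLength (hgen : Subgroup.closure S = ⊤) (g : G) :
    ∃ l : List G, l.length = wordLength S g ∧ (∀ s ∈ l, s ∈ S ∨ s⁻¹ ∈ S) ∧ l.prod = g := by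
  have hg : g ∈ (Subgroup.closure S).toSubmonoid := hgen ▸ Subgroup.mem_top g
  rw [Subgroup.closure_toSubmonoid] at hg
  obtain ⟨l, hl, hp⟩ := Submonoid.exists_list_of_mem_closure hg
  exact Nat.sInf_mem
    (s := {m : ℕ | ∃ l : List G, l.length = m ∧ (∀ s ∈ l, s ∈ S ∨ s⁻¹ ∈ S) ∧ l.prod = g})
    ⟨l.length, l, rfl, hl, hp⟩

@[simp]
theorem wordLength_one : wordLength S (1 : G) = 0 :=
  Nat.le_zero.1 (wordLength_le_length (S := S) (l := []) (by simp))

theorem wordLength_mul_le (hgen : Subgroup.closure S = ⊤) (a b : G) :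
    wordLength S (a * b) ≤ wordLength S a + wordLength S b := by
  obtain ⟨l, hl, hs, rfl⟩ := exists_list_wordLength hgen a
  obtain ⟨m, hm, ht, rfl⟩ := exists_list_wordLength hgen b
  rw [← List.prod_append, ← hl, ← hm, ← List.length_append]
  exact wordLength_le_length fun s h => (List.mem_append.1 h).elim (hs s) (ht s)

theorem wordLength_inv_le (hgen : Subgroup.closure S = ⊤) (a : G) :
    wordLength S a⁻¹ ≤ wordLength S a := by
  obtain ⟨l, hl, hs, rfl⟩ := exists_list_wordLength hgen a
  rw [List.prod_inv_reverse, ← hl]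
  refine (wordLength_le_length fun s h => ?_).trans (by simp)
  simp only [List.mem_reverse, List.mem_map] at h
  obtain ⟨t, ht, rfl⟩ := h
  simpa [or_comm] using hs t ht

theorem eq_one_of_wordLength_eq_zero (hgen : Subgroup.closure S = ⊤) {a : G}
    (h : wordLength S a = 0) : a = 1 := by
  obtain ⟨l, hl, -, rfl⟩ := exists_list_wordLength hgen a
  rw [h, List.length_eq_zero_iff] at hl
  simp [hl]

theorem wordLength_pow_le (hgen : Subgroup.closure S = ⊤) (a : G) (m : ℕ) :
    wordLength S (a ^ m) ≤ m * wordLength S a := by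
  induction m with
  | zero => simp
  | succ m ih =>
    rw [pow_succ, add_mul, one_mul]
    exact (wordLength_mul_le hgen _ _).trans (by gcongr)

theorem wordLength_zpow_le (hgen : Subgroup.closure S = ⊤) (a : G) (m : ℤ) :
    wordLength S (a ^ m) ≤ m.natAbs * wordLength S a := by
  obtain ⟨m, rfl | rfl⟩ := m.eq_nat_or_neg
  · simpa using wordLength_pow_le hgen a m
  · simpa using (wordLength_inv_le hgen _).trans (wordLength_pow_le hgen a m)

theorem wordLength_list_prod_le (hgen : Subgroup.closure S = ⊤) (l : List G) :
    wordLength S l.prod ≤ (l.map (wordLength S)).sum := by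
  induction l with
  | nil => simp
  | cons a l ih =>
    simp only [List.prod_cons, List.map_cons, List.sum_cons]
    exact (wordLength_mul_le hgen _ _).trans (by gcongr)

/-- A homomorphism from `ℤᵐ` is Lipschitz from the sup norm to the word length. -/
theorem exists_wordLength_hom_le (hgen : Subgroup.closure S = ⊤) {m : ℕ}
    (f : Multiplicative (Fin m → ℤ) →* G) :
    ∃ C : ℝ, 0 ≤ C ∧ ∀ x : Fin m → ℤ,
      (wordLength S (f (Multiplicative.ofAdd x)) : ℝ) ≤ C * ‖x‖ := by
  refine ⟨∑ j : Fin m, (wordLength S (f (Multiplicative.ofAdd (Pi.single j 1))) : ℝ),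
    by positivity, fun x => ?_⟩
  have hx : x = ((List.finRange m).map fun j => x j • (Pi.single j (1 : ℤ) : Fin m → ℤ)).sum := by
    rw [← List.ofFn_eq_map, List.sum_ofFn]
    ext i
    simp [Finset.sum_apply, Pi.single_apply]
  have hf : f (Multiplicative.ofAdd x) =
      ((List.finRange m).map fun j => f (Multiplicative.ofAdd (Pi.single j 1)) ^ x j).prod := by
    conv_lhs => rw [hx]
    rw [ofAdd_list_prod, map_list_prod, List.map_map, List.map_map]
    congr 1
    refine List.map_congr_left fun j _ => ?_
    simp only [Function.comp_apply, ofAdd_zsmul, map_zpow]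
  rw [hf, Finset.sum_mul]
  refine (Nat.cast_le.2 (wordLength_list_prod_le hgen _)).trans ?_
  rw [List.map_map, ← List.ofFn_eq_map, List.sum_ofFn, Nat.cast_sum]
  refine Finset.sum_le_sum fun j _ => ?_
  simp only [Function.comp_apply]
  refine (Nat.cast_le.2 (wordLength_zpow_le hgen _ _)).trans ?_
  rw [Nat.cast_mul, mul_comm]
  gcongr
  refine le_trans (le_of_eq ?_) (norm_le_pi_norm x j)
  rw [Int.norm_eq_abs, Nat.cast_natAbs, Int.cast_abs]

/-- If `a` can be joined to `b` inside a finite set by a chain of conjugations, each by an element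
of length at most `B`, then a shortest such chain visits no point twice, which bounds the length
of a conjugator from `a` to `b`. -/
theorem exists_conj_wordLength_le_of_chain (hgen : Subgroup.closure S = ⊤) (F : Finset G) (B : ℕ)
    {a b : G}
    (h : Relation.ReflTransGen (fun p q => p ∈ F ∧ q ∈ F ∧
      ∃ c, p * c = c * q ∧ wordLength S c ≤ B) a b) :
    ∃ c, a * c = c * b ∧ wordLength S c ≤ F.card * B := by
  classical
  by_cases ha : a ∈ F
  swap
  · rcases Relation.ReflTransGen.cases_head h with rfl | ⟨_, h', -⟩
    · exact ⟨1, by simp, by simp⟩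
    · exact absurd h'.1 ha
  let r : F → F → Prop := fun p q => ∃ c, p.1 * c = c * q.1 ∧ wordLength S c ≤ B
  have hsymm : ∀ p q, r p q → r q p := by
    rintro p q ⟨c, hc, hl⟩
    refine ⟨c⁻¹, ?_, (wordLength_inv_le hgen c).trans hl⟩
    rw [mul_inv_eq_iff_eq_mul, mul_assoc, hc, inv_mul_cancel_left]
  let Γ : SimpleGraph F := SimpleGraph.fromRel r
  have hwalk : ∀ {p q : F} (w : Γ.Walk p q),
      ∃ c, p.1 * c = c * q.1 ∧ wordLength S c ≤ w.length * B := by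
    intro p q w
    induction w with
    | nil => exact ⟨1, by simp, by simp⟩
    | cons hadj w ih =>
      obtain ⟨d, hd, hdl⟩ := ih
      obtain ⟨c, hc, hcl⟩ : r _ _ := hadj.2.elim id (hsymm _ _)
      refine ⟨c * d, ?_, ?_⟩
      · rw [← mul_assoc, hc, mul_assoc, hd, mul_assoc]
      · rw [SimpleGraph.Walk.length_cons, add_mul, one_mul, add_comm]
        exact (wordLength_mul_le hgen _ _).trans (by gcongr)
  have hreach : ∀ {q : G}, Relation.ReflTransGen (fun p q => p ∈ F ∧ q ∈ F ∧
      ∃ c, p * c = c * q ∧ wordLength S c ≤ B) a q →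
      ∃ hq : q ∈ F, Γ.Reachable ⟨a, ha⟩ ⟨q, hq⟩ := by
    intro q hq
    induction hq with
    | refl => exact ⟨ha, SimpleGraph.Reachable.refl _⟩
    | tail _ hstep ih =>
      obtain ⟨hp, hq, hc⟩ := hstep
      obtain ⟨_, hR⟩ := ih
      refine ⟨hq, hR.trans ?_⟩
      by_cases hne : (⟨_, hp⟩ : F) = ⟨_, hq⟩
      · rw [hne]
      · exact SimpleGraph.Adj.reachable ⟨hne, Or.inl hc⟩
  obtain ⟨hb, hR⟩ := hreach h
  obtain ⟨w, hw⟩ := hR.exists_isPath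
  obtain ⟨c, hc, hl⟩ := hwalk w
  refine ⟨c, hc, hl.trans ?_⟩
  have := hw.length_lt
  rw [Fintype.card_coe] at this
  gcongr

end WordLength

/-! ### Joint diagonalization -/

open Polynomial in
theorem Polynomial.norm_trailingCoeff_prod_X_sub_C {ι : Type*} (s : Finset ι) (f : ι → ℂ) :
    ‖(∏ i ∈ s, (X - C (f i))).trailingCoeff‖ = ∏ i ∈ s, if f i = 0 then 1 else ‖f i‖ := by
  classical
  induction s using Finset.induction_on with
  | empty => simp [trailingCoeff]
  | insert a s ha ih =>
    rw [Finset.prod_insert ha, Finset.prod_insert ha, Polynomial.trailingCoeff_mul, norm_mul, ih]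
    congr 1
    split_ifs with h
    · simp [h, trailingCoeff]
    · have : (X - C (f a)).natTrailingDegree = 0 := by
        rw [natTrailingDegree_eq_zero]; right; simpa using h
      simp [trailingCoeff, this]

/-- The joint eigenvectors of a commuting family of diagonalizable endomorphisms of a
finite-dimensional space contain a basis. -/
theorem Module.End.exists_basis_of_commute_of_isSemisimple {ι V : Type*} [AddCommGroup V]
    [Module ℂ V] [FiniteDimensional ℂ V] (f : ι → Module.End ℂ V)
    (hcomm : ∀ i j, Commute (f i) (f j)) (hss : ∀ i, (f i).IsSemisimple) :
    ∃ (b : Module.Basis (Fin (Module.finrank ℂ V)) ℂ V)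
      (χ : Fin (Module.finrank ℂ V) → ι → ℂ), ∀ i j, f i (b j) = χ j i • b j := by
  let s : Set V := {x | ∃ χ : ι → ℂ, ∀ i, f i x = χ i • x}
  have hs : ⊤ ≤ Submodule.span ℂ s := by
    rw [← Module.End.iSup_iInf_maxGenEigenspace_eq_top_of_iSup_maxGenEigenspace_eq_top_of_commute f
      (fun i j _ => hcomm i j) fun i => by
        rw [(hss i).iSup_maxGenEigenspace_eq_top_iff, (hss i).iSup_eigenspace_eq_top]]
    refine iSup_le fun χ x hx => Submodule.subset_span ⟨χ, fun i => ?_⟩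
    have := (Submodule.mem_iInf _).1 hx i
    rwa [(hss i).isFinitelySemisimple.maxGenEigenspace_eq_eigenspace,
      Module.End.mem_eigenspace_iff] at this
  let b := Module.Basis.ofSpan hs
  have : Fintype ((linearIndepOn_empty ℂ id).extend (Set.empty_subset s) : Set V) :=
    FiniteDimensional.fintypeBasisIndex b
  let e := Fintype.equivFinOfCardEq (Module.finrank_eq_card_basis b).symm
  have hb : ∀ j, b.reindex e j ∈ s := fun j => by
    rw [Module.Basis.reindex_apply]
    exact Module.Basis.ofSpan_subset hs (Set.mem_range_self _)
  choose χ hχ using hb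
  exact ⟨b.reindex e, χ, fun i j => hχ j i⟩

/-- A joint diagonalization over `ℂ` of the matrices `φ v`: linear coordinates on `ℂⁿ` in which
`φ v` multiplies the `i`-th coordinate by `χ i v`. -/
structure JointDiagonalization {n k : ℕ}
    (φ : Multiplicative (Fin k → ℤ) →* Matrix.SpecialLinearGroup (Fin n) ℤ) where
  /-- the characters of `ℤᵏ` by which it acts on the joint eigenvectors -/
  χ : Fin n → Multiplicative (Fin k → ℤ) →* ℂ
  /-- the coordinates with respect to a basis of joint eigenvectors -/
  coord : (Fin n → ℂ) ≃ₗ[ℂ] (Fin n → ℂ)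
  coord_complexEnd : ∀ v x i, coord (complexEnd (φ v) x) i = χ i v * coord x i

theorem complexEnd_one (n : ℕ) : complexEnd (1 : Matrix.SpecialLinearGroup (Fin n) ℤ) = 1 := by
  simp [complexEnd, Matrix.map_one]
  rfl

theorem complexEnd_mul {n : ℕ} (A B : Matrix.SpecialLinearGroup (Fin n) ℤ) :
    complexEnd (A * B) = complexEnd A * complexEnd B := by
  have : ((A * B : Matrix.SpecialLinearGroup (Fin n) ℤ) : Matrix (Fin n) (Fin n) ℤ).map
      (Int.cast : ℤ → ℂ) = (A : Matrix (Fin n) (Fin n) ℤ).map (Int.cast : ℤ → ℂ) *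
        (B : Matrix (Fin n) (Fin n) ℤ).map (Int.cast : ℤ → ℂ) := by
    rw [Matrix.SpecialLinearGroup.coe_mul]
    exact Matrix.map_mul (f := Int.castRingHom ℂ)
  rw [complexEnd, this, Matrix.toLin'_mul]
  rfl

section

variable {n k : ℕ} {φ : Multiplicative (Fin k → ℤ) →* Matrix.SpecialLinearGroup (Fin n) ℤ}

theorem JointDiagonalization.nonempty (hss : ∀ v, IsSemisimpleSL (φ v)) :
    Nonempty (JointDiagonalization φ) := by
  have hcomm : ∀ v w, Commute (complexEnd (φ v)) (complexEnd (φ w)) := fun v w => by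
    rw [Commute, SemiconjBy, ← complexEnd_mul, ← complexEnd_mul, ← map_mul, ← map_mul, mul_comm]
  obtain ⟨b, χ, hχ⟩ := Module.End.exists_basis_of_commute_of_isSemisimple
    (fun v => complexEnd (φ v)) hcomm hss
  have hn : Module.finrank ℂ (Fin n → ℂ) = n := by simp
  let b' := b.reindex (finCongr hn)
  let χ' : Fin n → Multiplicative (Fin k → ℤ) → ℂ := fun i => χ ((finCongr hn).symm i)
  have hb : ∀ v j, complexEnd (φ v) (b' j) = χ' j v • b' j := fun v j => by
    simpa [b', χ'] using hχ v ((finCongr hn).symm j)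
  have hne := b'.ne_zero
  refine ⟨⟨fun i => ⟨⟨χ' i, ?_⟩, fun v w => ?_⟩, b'.equivFun, fun v x i => ?_⟩⟩
  · have := hb 1 i
    rw [map_one, complexEnd_one, Module.End.one_apply] at this
    exact smul_left_injective ℂ (hne i) (this.symm.trans (one_smul ℂ _).symm)
  · have := hb (v * w) i
    rw [map_mul, complexEnd_mul, Module.End.mul_apply, hb w, map_smul, hb v, smul_smul] at this
    exact smul_left_injective ℂ (hne i) (this.symm.trans (by rw [mul_comm]))
  · change _ = χ' i v * _
    conv_lhs => rw [← b'.sum_repr x]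
    rw [map_sum, map_sum, Finset.sum_apply]
    simp only [map_smul, hb, Pi.smul_apply, Module.Basis.equivFun_self, smul_eq_mul]
    rw [Finset.sum_eq_single i]
    · simp [mul_comm]
    · intro j _ hj
      simp [hj]
    · simp

namespace JointDiagonalization

variable (d : JointDiagonalization φ)

theorem χ_ne_zero (i : Fin n) (v : Multiplicative (Fin k → ℤ)) : d.χ i v ≠ 0 := by
  intro h
  have : d.χ i (v * v⁻¹) = 1 := by rw [mul_inv_cancel, map_one]
  rw [map_mul, h, zero_mul] at this
  exact zero_ne_one this

theorem norm_χ_pos (i : Fin n) (v : Multiplicative (Fin k → ℤ)) : 0 < ‖d.χ i v‖ :=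
  norm_pos_iff.2 (d.χ_ne_zero i v)

theorem hasEigenvalue (i : Fin n) (v : Multiplicative (Fin k → ℤ)) :
    (complexEnd (φ v)).HasEigenvalue (d.χ i v) := by
  refine Module.End.hasEigenvalue_of_hasEigenvector (x := d.coord.symm (Pi.single i 1))
    (Module.End.hasEigenvector_iff.2 ⟨Module.End.mem_eigenspace_iff.2 ?_, ?_⟩)
  · apply d.coord.injective
    ext j
    rw [d.coord_complexEnd, map_smul, LinearEquiv.apply_symm_apply]
    rcases eq_or_ne j i with rfl | h <;> simp [*]
  · simp

/-- The coordinates of a real vector. -/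
noncomputable def realCoord : (Fin n → ℝ) →ₗ[ℝ] (Fin n → ℂ) :=
  (d.coord.toLinearMap.restrictScalars ℝ).comp
    (LinearMap.compLeft Complex.ofRealCLM.toLinearMap (Fin n))

/-- The real part of the vector with given coordinates. As not every coordinate vector comes from
a real vector, this is only a left inverse of `realCoord`. -/
noncomputable def recon : (Fin n → ℂ) →ₗ[ℝ] (Fin n → ℝ) :=
  (LinearMap.compLeft Complex.reLm (Fin n)).comp (d.coord.symm.toLinearMap.restrictScalars ℝ)

theorem realCoord_apply (y : Fin n → ℝ) : d.realCoord y = d.coord fun j => (y j : ℂ) := rfl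

theorem recon_apply (z : Fin n → ℂ) (j : Fin n) : d.recon z j = (d.coord.symm z j).re := rfl

@[simp]
theorem recon_realCoord (y : Fin n → ℝ) : d.recon (d.realCoord y) = y := by
  ext j
  simp [recon_apply, realCoord_apply]

/-- The inclusion of `ℤⁿ` in `ℝⁿ`. -/
def _root_.intVec (n : ℕ) : (Fin n → ℤ) →+ (Fin n → ℝ) :=
  (Int.castAddHom ℝ).compLeft (Fin n)

@[simp]
theorem _root_.intVec_apply (x : Fin n → ℤ) (j : Fin n) : intVec n x j = x j := rfl

@[simp]
theorem _root_.norm_intVec (x : Fin n → ℤ) : ‖intVec n x‖ = ‖x‖ := by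
  simp [Pi.norm_def, nnnorm, Int.norm_eq_abs]

theorem _root_.intVec_mulVec (A : Matrix (Fin n) (Fin n) ℤ) (x : Fin n → ℤ) :
    intVec n (A.mulVec x) = (A.map (Int.cast : ℤ → ℝ)).mulVec (intVec n x) := by
  ext j
  simp [Matrix.mulVec, dotProduct]

/-- The coordinates of an integer vector. -/
noncomputable def intCoord : (Fin n → ℤ) →+ (Fin n → ℂ) :=
  d.realCoord.toAddMonoidHom.comp (intVec n)

theorem intCoord_apply (x : Fin n → ℤ) : d.intCoord x = d.realCoord (intVec n x) := rfl

@[simp]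
theorem recon_intCoord (x : Fin n → ℤ) : d.recon (d.intCoord x) = intVec n x :=
  d.recon_realCoord _

theorem complexEnd_apply (A : Matrix.SpecialLinearGroup (Fin n) ℤ) (x : Fin n → ℂ) :
    complexEnd A x = (A.1.map (Int.cast : ℤ → ℂ)).mulVec x := rfl

theorem realCoord_mulVec (v : Multiplicative (Fin k → ℤ)) (y : Fin n → ℝ) (i : Fin n) :
    d.realCoord (((φ v).1.map (Int.cast : ℤ → ℝ)).mulVec y) i = d.χ i v * d.realCoord y i := by
  rw [realCoord_apply, realCoord_apply, ← d.coord_complexEnd]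
  refine congrFun (congrArg d.coord (funext fun j => ?_)) i
  simp [complexEnd_apply, Matrix.mulVec, dotProduct]

theorem intCoord_mulVec (v : Multiplicative (Fin k → ℤ)) (x : Fin n → ℤ) (i : Fin n) :
    d.intCoord ((φ v).1.mulVec x) i = d.χ i v * d.intCoord x i := by
  rw [intCoord_apply, intVec_mulVec, realCoord_mulVec, intCoord_apply]

theorem recon_mulVec (v : Multiplicative (Fin k → ℤ)) (z : Fin n → ℂ) :
    d.recon (fun i => d.χ i v * z i) =
      ((φ v).1.map (Int.cast : ℤ → ℝ)).mulVec (d.recon z) := by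
  have h : d.coord.symm (fun i => d.χ i v * z i) = complexEnd (φ v) (d.coord.symm z) := by
    rw [LinearEquiv.symm_apply_eq]
    ext i
    rw [d.coord_complexEnd, LinearEquiv.apply_symm_apply]
  ext j
  rw [recon_apply, h]
  simp [complexEnd_apply, Matrix.mulVec, dotProduct, recon_apply]

/-- A common Lipschitz constant, at least one, of `realCoord` and `recon` in the sup norms. -/
noncomputable def bound : ℝ :=
  1 + (‖LinearMap.toContinuousLinearMap d.realCoord‖ + ‖LinearMap.toContinuousLinearMap d.recon‖)

theorem one_le_bound : 1 ≤ d.bound := by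
  unfold bound
  linarith [norm_nonneg (LinearMap.toContinuousLinearMap d.realCoord),
    norm_nonneg (LinearMap.toContinuousLinearMap d.recon)]

theorem bound_pos : 0 < d.bound := zero_lt_one.trans_le d.one_le_bound

theorem norm_realCoord_le (y : Fin n → ℝ) : ‖d.realCoord y‖ ≤ d.bound * ‖y‖ := by
  refine ((LinearMap.toContinuousLinearMap d.realCoord).le_opNorm y).trans ?_
  gcongr
  unfold bound
  linarith [norm_nonneg (LinearMap.toContinuousLinearMap d.recon)]

theorem norm_recon_le (z : Fin n → ℂ) : ‖d.recon z‖ ≤ d.bound * ‖z‖ := by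
  refine ((LinearMap.toContinuousLinearMap d.recon).le_opNorm z).trans ?_
  gcongr
  unfold bound
  linarith [norm_nonneg (LinearMap.toContinuousLinearMap d.realCoord)]

theorem norm_intCoord_le (x : Fin n → ℤ) : ‖d.intCoord x‖ ≤ d.bound * ‖x‖ := by
  simpa [intCoord_apply] using d.norm_realCoord_le (intVec n x)

theorem norm_le_intCoord (x : Fin n → ℤ) : ‖x‖ ≤ d.bound * ‖d.intCoord x‖ := by
  simpa using d.norm_recon_le (d.intCoord x)

theorem intCoord_injective : Function.Injective d.intCoord := by
  rw [injective_iff_map_eq_zero]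
  intro x hx
  have := d.norm_le_intCoord x
  rw [hx, norm_zero, mul_zero] at this
  exact norm_le_zero_iff.1 this

theorem norm_mulVec_le {v : Multiplicative (Fin k → ℤ)} {K : ℝ} (hK : 0 ≤ K)
    (hv : ∀ i, ‖d.χ i v‖ ≤ K) (y : Fin n → ℝ) :
    ‖((φ v).1.map (Int.cast : ℤ → ℝ)).mulVec y‖ ≤ d.bound ^ 2 * K * ‖y‖ := by
  have hb := d.bound_pos.le
  have h : ‖d.realCoord (((φ v).1.map (Int.cast : ℤ → ℝ)).mulVec y)‖ ≤ K * (d.bound * ‖y‖) := by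
    refine (pi_norm_le_iff_of_nonneg (by positivity)).2 fun i => ?_
    rw [realCoord_mulVec, norm_mul]
    exact mul_le_mul (hv i) ((norm_le_pi_norm _ i).trans (d.norm_realCoord_le y))
      (norm_nonneg _) hK
  have h' := d.norm_recon_le (d.realCoord (((φ v).1.map (Int.cast : ℤ → ℝ)).mulVec y))
  rw [recon_realCoord] at h'
  calc _ ≤ d.bound * (K * (d.bound * ‖y‖)) := h'.trans (by gcongr)
    _ = _ := by ring

/-- The integer vector obtained by rounding the entries of `recon z`. -/
noncomputable def lattice (z : Fin n → ℂ) : Fin n → ℤ := fun j => round (d.recon z j)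

theorem norm_intVec_lattice_sub_le (z : Fin n → ℂ) :
    ‖intVec n (d.lattice z) - d.recon z‖ ≤ 1 := by
  refine (pi_norm_le_iff_of_nonneg zero_le_one).2 fun j => ?_
  rw [Pi.sub_apply, Real.norm_eq_abs, abs_sub_comm]
  exact (abs_sub_round _).trans (by norm_num)

theorem norm_lattice_le (z : Fin n → ℂ) : ‖d.lattice z‖ ≤ 1 + d.bound * ‖z‖ := by
  rw [← norm_intVec, ← sub_add_cancel (intVec n (d.lattice z)) (d.recon z)]
  exact (norm_add_le _ _).trans (add_le_add (d.norm_intVec_lattice_sub_le z) (d.norm_recon_le z))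

theorem charpoly_map (v : Multiplicative (Fin k → ℤ)) :
    (((φ v).1 - 1).charpoly.map (Int.castRingHom ℂ)) =
      ∏ i, (Polynomial.X - Polynomial.C (d.χ i v - 1)) := by
  have h : d.coord.conj (Matrix.toLin' (((φ v).1 - 1).map (Int.castRingHom ℂ))) =
      Matrix.toLin' (Matrix.diagonal fun i => d.χ i v - 1) := by
    refine LinearMap.ext fun x => ?_
    ext i
    have h' : ((φ v).1 - 1).map (Int.castRingHom ℂ) =
        (φ v).1.map (Int.cast : ℤ → ℂ) - 1 := by
      rw [Matrix.map_sub _ (map_sub _), Matrix.map_one _ (map_zero _) (map_one _)]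
      rfl
    rw [LinearEquiv.conj_apply_apply, h', Matrix.toLin'_apply, Matrix.toLin'_apply,
      Matrix.sub_mulVec, ← complexEnd_apply, map_sub, Pi.sub_apply, d.coord_complexEnd,
      Matrix.one_mulVec, LinearEquiv.apply_symm_apply, Matrix.mulVec_diagonal, sub_mul, one_mul]
  rw [← Matrix.charpoly_map, ← Matrix.charpoly_diagonal, ← Matrix.charpoly_toLin',
    ← Matrix.charpoly_toLin', ← h, LinearEquiv.charpoly_conj]

theorem intCoord_aeval_mulVec (v : Multiplicative (Fin k → ℤ)) (p : Polynomial ℤ)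
    (x : Fin n → ℤ) (i : Fin n) :
    d.intCoord ((Polynomial.aeval ((φ v).1 - 1) p).mulVec x) i =
      (p.map (Int.castRingHom ℂ)).eval (d.χ i v - 1) * d.intCoord x i := by
  induction p using Polynomial.induction_on generalizing x with
  | C a =>
    rw [Polynomial.aeval_C, Algebra.algebraMap_eq_smul_one, Matrix.smul_mulVec, map_zsmul]
    simp
  | add p q hp hq => simp [Matrix.add_mulVec, hp, hq, add_mul]
  | monomial m a h =>
    rw [pow_succ, ← mul_assoc, map_mul, ← Matrix.mulVec_mulVec, h, Polynomial.aeval_X,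
      Matrix.sub_mulVec, map_sub, Pi.sub_apply, intCoord_mulVec, Matrix.one_mulVec]
    simp
    ring

/-- The kernel of `φ v - 1` is the range of an integer matrix `P`, which is `D` times the
projection along the other joint eigenvectors. As `D` is an integer and up to sign the product of
the nonzero eigenvalues of `φ v - 1`, it bounds these eigenvalues from below. -/
theorem exists_kernel_projection (v : Multiplicative (Fin k → ℤ)) :
    ∃ (D : ℤ) (P : Matrix (Fin n) (Fin n) ℤ), 0 < D ∧
      (D : ℝ) = ∏ i, (if d.χ i v = 1 then 1 else ‖d.χ i v - 1‖) ∧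
      ∀ x i, d.intCoord (P.mulVec x) i = if d.χ i v = 1 then (D : ℂ) * d.intCoord x i else 0 := by
  set T : Matrix (Fin n) (Fin n) ℤ := (φ v).1 - 1 with hT
  have hne : T.charpoly ≠ 0 := T.charpoly_monic.ne_zero
  -- Write the characteristic polynomial as `X ^ m * g` with `g.coeff 0 ≠ 0`. On the eigenvectors,
  -- `g` takes the value `g.coeff 0` at the eigenvalue `0`, and vanishes at the other eigenvalues.
  obtain ⟨g, hg⟩ := Polynomial.X_pow_dvd_iff.2
    fun j hj => Polynomial.coeff_eq_zero_of_lt_natTrailingDegree (p := T.charpoly) hj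
  have hcoeff : g.coeff 0 = T.charpoly.trailingCoeff := by
    rw [Polynomial.trailingCoeff]
    have := Polynomial.coeff_X_pow_mul g T.charpoly.natTrailingDegree 0
    rwa [← hg, zero_add, eq_comm] at this
  have hg0 : g.coeff 0 ≠ 0 := hcoeff ▸ Polynomial.trailingCoeff_nonzero_iff_nonzero.2 hne
  have hnorm : ((|g.coeff 0| : ℤ) : ℝ) =
      ∏ i, (if d.χ i v = 1 then 1 else ‖d.χ i v - 1‖) := by
    have h := Polynomial.norm_trailingCoeff_prod_X_sub_C Finset.univ fun i => d.χ i v - 1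
    have htr : (T.charpoly.map (Int.castRingHom ℂ)).trailingCoeff = (g.coeff 0 : ℂ) := by
      have hdeg : (g.map (Int.castRingHom ℂ)).natTrailingDegree = 0 := by
        rw [Polynomial.natTrailingDegree_eq_zero]
        right
        simpa using hg0
      rw [hg, Polynomial.map_mul, Polynomial.map_pow, Polynomial.map_X,
        Polynomial.trailingCoeff_mul, Polynomial.trailingCoeff, Polynomial.trailingCoeff, hdeg]
      simp
    rw [← d.charpoly_map v, htr] at h
    simpa [sub_eq_zero] using h
  have heval : ∀ i, (g.map (Int.castRingHom ℂ)).eval (d.χ i v - 1) =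
      if d.χ i v = 1 then (g.coeff 0 : ℂ) else 0 := by
    intro i
    split_ifs with h
    · rw [h, sub_self, ← Polynomial.coeff_zero_eq_eval_zero, Polynomial.coeff_map]
      rfl
    · have h0 : (T.charpoly.map (Int.castRingHom ℂ)).eval (d.χ i v - 1) = 0 := by
        rw [d.charpoly_map v, Polynomial.eval_prod]
        exact Finset.prod_eq_zero (Finset.mem_univ i) (by simp)
      rw [hg, Polynomial.map_mul, Polynomial.eval_mul] at h0
      refine (mul_eq_zero.1 h0).resolve_left ?_
      simpa [sub_eq_zero] using fun h' => absurd h' h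
  refine ⟨|g.coeff 0|, (g.coeff 0).sign • Polynomial.aeval T g, abs_pos.2 hg0, hnorm,
    fun x i => ?_⟩
  rw [Matrix.smul_mulVec, map_zsmul, Pi.smul_apply, hT, d.intCoord_aeval_mulVec, heval,
    ← Int.sign_mul_self_eq_abs]
  split_ifs
  · push_cast
    rw [zsmul_eq_mul, mul_assoc]
  · simp

end JointDiagonalization

end

/-! ### Word length in the semidirect product -/

section

variable {n k : ℕ} {φ : Multiplicative (Fin k → ℤ) →* Matrix.SpecialLinearGroup (Fin n) ℤ}

/-- The element `(x, v)` of `ℤⁿ ⋊ ℤᵏ`. -/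
def latticeElt (φ : Multiplicative (Fin k → ℤ) →* Matrix.SpecialLinearGroup (Fin n) ℤ)
    (x : Fin n → ℤ) (v : Multiplicative (Fin k → ℤ)) : LatticeSemidirect φ :=
  ⟨Multiplicative.ofAdd x, v⟩

theorem latticeElt_mul (u x : Fin n → ℤ) (v y : Multiplicative (Fin k → ℤ)) :
    latticeElt φ u v * latticeElt φ x y = latticeElt φ (u + (φ v).1.mulVec x) (v * y) := rfl

theorem latticeElt_inj {u x : Fin n → ℤ} {v y : Multiplicative (Fin k → ℤ)} :
    latticeElt φ u v = latticeElt φ x y ↔ u = x ∧ v = y := by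
  constructor
  · intro h
    exact ⟨congrArg (fun g : LatticeSemidirect φ => Multiplicative.toAdd g.left) h,
      congrArg (fun g : LatticeSemidirect φ => g.right) h⟩
  · rintro ⟨rfl, rfl⟩
    rfl

theorem exists_eq_latticeElt (g : LatticeSemidirect φ) : ∃ x v, g = latticeElt φ x v :=
  ⟨Multiplicative.toAdd g.left, g.right, rfl⟩

theorem latticeElt_conj_iff {u w x : Fin n → ℤ} {v y : Multiplicative (Fin k → ℤ)} :
    latticeElt φ u v * latticeElt φ x y = latticeElt φ x y * latticeElt φ w v ↔
      u + (φ v).1.mulVec x = x + (φ y).1.mulVec w := by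
  rw [latticeElt_mul, latticeElt_mul, latticeElt_inj, mul_comm y v]
  simp

theorem mulVec_mul (v y : Multiplicative (Fin k → ℤ)) (x : Fin n → ℤ) :
    (φ (v * y)).1.mulVec x = (φ v).1.mulVec ((φ y).1.mulVec x) := by
  rw [map_mul, Matrix.mulVec_mulVec]
  rfl

theorem one_mulVec (x : Fin n → ℤ) :
    (φ 1).1.mulVec x = x := by
  rw [map_one]
  exact Matrix.one_mulVec x

variable {S : Set (LatticeSemidirect φ)}

theorem exists_wordLength_latticeElt_le (hgen : Subgroup.closure S = ⊤) :
    ∃ C : ℝ, 1 ≤ C ∧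
      (∀ x, (wordLength S (latticeElt φ x 1) : ℝ) ≤ C * ‖x‖) ∧
      ∀ x y, (wordLength S (latticeElt φ x y) : ℝ) ≤
        wordLength S (latticeElt φ x 1) + C * ‖Multiplicative.toAdd y‖ := by
  obtain ⟨C₁, h₁, hC₁⟩ := exists_wordLength_hom_le hgen
    (SemidirectProduct.inl : _ →* LatticeSemidirect φ)
  obtain ⟨C₂, h₂, hC₂⟩ := exists_wordLength_hom_le hgen
    (SemidirectProduct.inr : _ →* LatticeSemidirect φ)
  refine ⟨1 + C₁ + C₂, by linarith, fun x => (hC₁ x).trans ?_, fun x y => ?_⟩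
  · gcongr
    linarith
  · have h : latticeElt φ x y = latticeElt φ x 1 * SemidirectProduct.inr y :=
      (SemidirectProduct.inl_left_mul_inr_right (latticeElt φ x y)).symm
    rw [h]
    refine (Nat.cast_le.2 (wordLength_mul_le hgen _ _)).trans ?_
    rw [Nat.cast_add]
    gcongr
    refine (hC₂ (Multiplicative.toAdd y)).trans ?_
    gcongr
    linarith

namespace JointDiagonalization

variable (d : JointDiagonalization φ)

/-- Along a word of length `L`, the `ℤᵏ`-part grows at most linearly in `L`, the coordinates of the
`ℤⁿ`-part at most exponentially, and those on which `ℤᵏ` acts isometrically at most linearly. -/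
theorem exists_coord_le_wordLength (hfin : S.Finite) (hgen : Subgroup.closure S = ⊤) :
    ∃ K : ℝ, 2 ≤ K ∧ ∀ u v,
      ‖Multiplicative.toAdd v‖ ≤ K * wordLength S (latticeElt φ u v) ∧
      ∀ i, ‖d.χ i v‖ ≤ K ^ wordLength S (latticeElt φ u v) ∧
        ‖d.intCoord u i‖ ≤ K ^ (2 * wordLength S (latticeElt φ u v)) ∧
        ((∀ y, ‖d.χ i y‖ = 1) →
          ‖d.intCoord u i‖ ≤ K * wordLength S (latticeElt φ u v)) := by
  let f : LatticeSemidirect φ → ℝ := fun s => ‖Multiplicative.toAdd s.right‖ +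
    ∑ i, ‖d.χ i s.right‖ + ∑ i, ‖d.intCoord (Multiplicative.toAdd s.left) i‖
  obtain ⟨K₀, hK₀⟩ := ((hfin.union hfin.inv).image f).bddAbove
  have hf : ∀ s, s ∈ S ∨ s⁻¹ ∈ S → f s ≤ K₀ := fun s hs => hK₀ ⟨s, by simpa using hs, rfl⟩
  set K := max 2 K₀ with hK
  have hK2 : 2 ≤ K := le_max_left _ _
  -- Prepending a letter multiplies the coordinates by at most `K` and adds at most `K`, whence the
  -- factor `l.length`, which is absorbed into another power of `K` at the end.
  have key : ∀ l : List (LatticeSemidirect φ), (∀ s ∈ l, s ∈ S ∨ s⁻¹ ∈ S) →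
      ‖Multiplicative.toAdd l.prod.right‖ ≤ K * l.length ∧
      ∀ i, ‖d.χ i l.prod.right‖ ≤ K ^ l.length ∧
        ‖d.intCoord (Multiplicative.toAdd l.prod.left) i‖ ≤ l.length * K ^ l.length ∧
        ((∀ y, ‖d.χ i y‖ = 1) →
          ‖d.intCoord (Multiplicative.toAdd l.prod.left) i‖ ≤ K * l.length) := by
    intro l
    induction l with
    | nil => intro _; simp
    | cons s l ih =>
      intro hl
      obtain ⟨ih₁, ih₂⟩ := ih fun t ht => hl t (List.mem_cons_of_mem _ ht)
      have hs : f s ≤ K := (hf s (hl s List.mem_cons_self)).trans (le_max_right _ _)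
      have hsum₁ : 0 ≤ ∑ i, ‖d.χ i s.right‖ := by positivity
      have hsum₂ : 0 ≤ ∑ i, ‖d.intCoord (Multiplicative.toAdd s.left) i‖ := by positivity
      have hn := norm_nonneg (Multiplicative.toAdd s.right)
      simp only [f] at hs
      have hleft : Multiplicative.toAdd (s * l.prod).left = Multiplicative.toAdd s.left +
          (φ s.right).1.mulVec (Multiplicative.toAdd l.prod.left) := rfl
      have hright : Multiplicative.toAdd (s * l.prod).right = Multiplicative.toAdd s.right +
          Multiplicative.toAdd l.prod.right := rfl
      simp only [List.prod_cons, List.length_cons, Nat.cast_add, Nat.cast_one]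
      refine ⟨?_, fun i => ?_⟩
      · rw [hright]
        refine (norm_add_le _ _).trans ?_
        linarith
      obtain ⟨h₁, h₂, h₃⟩ := ih₂ i
      have hχ : ‖d.χ i s.right‖ ≤ K := by
        linarith [Finset.single_le_sum (f := fun i => ‖d.χ i s.right‖)
          (fun i _ => norm_nonneg _) (Finset.mem_univ i)]
      have hc : ‖d.intCoord (Multiplicative.toAdd s.left) i‖ ≤ K := by
        linarith [Finset.single_le_sum
          (f := fun i => ‖d.intCoord (Multiplicative.toAdd s.left) i‖)
          (fun i _ => norm_nonneg _) (Finset.mem_univ i)]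
      have hcoord : ‖d.intCoord (Multiplicative.toAdd (s * l.prod).left) i‖ ≤
          K + ‖d.χ i s.right‖ * ‖d.intCoord (Multiplicative.toAdd l.prod.left) i‖ := by
        rw [hleft, map_add, Pi.add_apply, d.intCoord_mulVec, ← norm_mul]
        exact (norm_add_le _ _).trans (by gcongr)
      refine ⟨?_, hcoord.trans ?_, fun hi => hcoord.trans ?_⟩
      · rw [SemidirectProduct.mul_right, map_mul, norm_mul, pow_succ']
        gcongr
      · have hp : (1 : ℝ) ≤ K ^ l.length := one_le_pow₀ (by linarith)
        calc K + ‖d.χ i s.right‖ * ‖d.intCoord (Multiplicative.toAdd l.prod.left) i‖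
            ≤ K * K ^ l.length + K * (l.length * K ^ l.length) := by
              gcongr
              exact le_mul_of_one_le_right (by linarith) hp
          _ = _ := by ring
      · rw [hi, one_mul]
        linarith [h₃ hi]
  refine ⟨K, hK2, fun u v => ?_⟩
  obtain ⟨l, hl, hs, hp⟩ := exists_list_wordLength hgen (latticeElt φ u v)
  obtain ⟨h₁, h₂⟩ := key l hs
  rw [hp, hl] at h₁ h₂
  refine ⟨h₁, fun i => ⟨(h₂ i).1, (h₂ i).2.1.trans ?_, (h₂ i).2.2⟩⟩
  rw [two_mul, pow_add]
  gcongr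
  calc ((wordLength S (latticeElt φ u v) : ℕ) : ℝ)
      ≤ 2 ^ wordLength S (latticeElt φ u v) := mod_cast Nat.lt_two_pow_self.le
    _ ≤ _ := by gcongr

/-- An integer solution of `(φ v - 1) x = b` can be moved by the integer vectors of the kernel,
so that its component in the kernel becomes bounded. -/
theorem exists_small_solution {v : Multiplicative (Fin k → ℤ)} {D : ℤ}
    {P : Matrix (Fin n) (Fin n) ℤ} (hD : 0 < D)
    (hP : ∀ x i, d.intCoord (P.mulVec x) i =
      if d.χ i v = 1 then (D : ℂ) * d.intCoord x i else 0) (x : Fin n → ℤ) :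
    ∃ x', (φ v).1.mulVec x' - x' = (φ v).1.mulVec x - x ∧
      ∀ i, (d.χ i v ≠ 1 → d.intCoord x' i = d.intCoord x i) ∧
        (d.χ i v = 1 → ‖d.intCoord x' i‖ ≤ d.bound * D) := by
  have hx : x = (fun j => x j % D) + D • fun j => x j / D := by
    ext j
    simp [Int.emod_add_mul_ediv]
  -- On the kernel `P` is multiplication by `D`, so that subtracting `P (x / D)` reduces the kernel
  -- component of `x` to that of `x % D`.
  refine ⟨x - P.mulVec fun j => x j / D, ?_, fun i => ⟨fun hi => ?_, fun hi => ?_⟩⟩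
  · apply d.intCoord_injective
    ext i
    simp only [map_sub, Pi.sub_apply, d.intCoord_mulVec, hP]
    split_ifs with h
    · rw [h]; ring
    · ring
  · simp [hP, hi]
  · have h : d.intCoord (x - P.mulVec fun j => x j / D) i = d.intCoord (fun j => x j % D) i := by
      rw [map_sub, Pi.sub_apply, hP, if_pos hi]
      rw [congrFun (congrArg d.intCoord hx) i, map_add, Pi.add_apply, map_zsmul, Pi.smul_apply,
        zsmul_eq_mul]
      simp
    rw [h]
    refine (norm_le_pi_norm _ i).trans ((d.norm_intCoord_le _).trans ?_)
    have hb := d.bound_pos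
    gcongr
    refine (pi_norm_le_iff_of_nonneg (by exact_mod_cast hD.le)).2 fun j => ?_
    rw [Int.norm_eq_abs]
    norm_cast
    rw [abs_of_nonneg (Int.emod_nonneg _ hD.ne')]
    exact (Int.emod_lt_of_pos _ hD).le

theorem coord_eq_of_mulVec_sub {v : Multiplicative (Fin k → ℤ)} {x b : Fin n → ℤ}
    (h : (φ v).1.mulVec x - x = b) (i : Fin n) :
    (d.χ i v - 1) * d.intCoord x i = d.intCoord b i := by
  rw [← h, map_sub, Pi.sub_apply, intCoord_mulVec]
  ring

end JointDiagonalization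

end

/-! ### Paths along straight lines and small solutions of linear equations -/

section

variable {n k : ℕ} {φ : Multiplicative (Fin k → ℤ) →* Matrix.SpecialLinearGroup (Fin n) ℤ}

theorem Int.abs_ediv_step_le {a : ℤ} {N : ℕ} (ha : |a| ≤ N) (j : ℕ) :
    |((j + 1 : ℕ) * a) / (N : ℤ) - (j * a) / (N : ℤ)| ≤ 1 := by
  rcases Nat.eq_zero_or_pos N with rfl | hN
  · simp
  have hN' : (0 : ℤ) < N := by exact_mod_cast hN
  obtain ⟨h₁, h₂⟩ := abs_le.1 ha
  have e₁ := Int.ediv_le_ediv hN' (show j * a + (-1) * N ≤ ((j + 1 : ℕ) * a : ℤ) by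
    push_cast; linarith)
  have e₂ := Int.ediv_le_ediv hN' (show ((j + 1 : ℕ) * a : ℤ) ≤ j * a + 1 * N by
    push_cast; linarith)
  rw [Int.add_mul_ediv_right _ _ hN'.ne'] at e₁ e₂
  rw [abs_le]
  constructor <;> linarith

namespace JointDiagonalization

variable (d : JointDiagonalization φ)

/-- The logarithm of the absolute value of a character. -/
noncomputable def logNorm (i : Fin n) : (Fin k → ℤ) →+ ℝ where
  toFun x := Real.log ‖d.χ i (Multiplicative.ofAdd x)‖
  map_zero' := by simp
  map_add' x y := by
    rw [ofAdd_add, map_mul, norm_mul,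
      Real.log_mul (d.norm_χ_pos _ _).ne' (d.norm_χ_pos _ _).ne']

theorem norm_χ_eq_exp (i : Fin n) (y : Multiplicative (Fin k → ℤ)) :
    ‖d.χ i y‖ = Real.exp (d.logNorm i (Multiplicative.toAdd y)) :=
  (Real.exp_log (d.norm_χ_pos i y)).symm

theorem logNorm_eq_sum (i : Fin n) (x : Fin k → ℤ) :
    d.logNorm i x = ∑ m, x m * d.logNorm i (Pi.single m 1) := by
  have hx : x = ∑ m, x m • (Pi.single m (1 : ℤ) : Fin k → ℤ) := by
    ext j
    simp [Finset.sum_apply, Pi.single_apply]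
  conv_lhs => rw [hx]
  rw [map_sum]
  refine Finset.sum_congr rfl fun m _ => ?_
  rw [map_zsmul, zsmul_eq_mul]

/-- The lattice points near the segment from `0` to `y` form a path with steps of norm at most one.
As the logarithm of `‖χ i‖` is linear, it is on this path bounded by its values at the ends, up to
a constant independent of `y`. -/
theorem exists_path : ∃ κ : ℝ, 1 ≤ κ ∧
    (∀ s : Multiplicative (Fin k → ℤ), ‖Multiplicative.toAdd s‖ ≤ 1 → ∀ i, ‖d.χ i s‖ ≤ κ) ∧
    ∀ y : Multiplicative (Fin k → ℤ), ∃ (N : ℕ) (p : ℕ → Multiplicative (Fin k → ℤ)),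
      p 0 = 1 ∧ p N = y ∧ (∀ j, ‖Multiplicative.toAdd (p (j + 1) / p j)‖ ≤ 1) ∧
      ∀ j ≤ N, ∀ i, ‖d.χ i (p j)‖ ≤ κ * max 1 ‖d.χ i y‖ := by
  let σ : ℝ := ∑ i, ∑ m, |d.logNorm i (Pi.single m 1)|
  have hσ : ∀ (i : Fin n) (x : Fin k → ℝ), (∀ m, |x m| ≤ 1) →
      ∑ m, x m * d.logNorm i (Pi.single m 1) ≤ σ := by
    intro i x hx
    refine le_trans (Finset.sum_le_sum fun m _ => ?_)
      (Finset.single_le_sum (f := fun i => ∑ m, |d.logNorm i (Pi.single m 1)|)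
        (fun i _ => by positivity) (Finset.mem_univ i))
    refine (le_abs_self _).trans ?_
    rw [abs_mul]
    exact mul_le_of_le_one_left (abs_nonneg _) (hx m)
  have hσ0 : 0 ≤ σ := by positivity
  refine ⟨Real.exp σ, Real.one_le_exp hσ0, fun s hs i => ?_, fun y => ?_⟩
  · rw [norm_χ_eq_exp, Real.exp_le_exp, logNorm_eq_sum]
    refine hσ i (fun m => ((Multiplicative.toAdd s m : ℤ) : ℝ)) fun m => ?_
    have := (norm_le_pi_norm (Multiplicative.toAdd s) m).trans hs
    rwa [Int.norm_eq_abs] at this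
  set a := Multiplicative.toAdd y with ha
  let N : ℕ := Finset.univ.sup fun m => (a m).natAbs
  have hN : ∀ m, |a m| ≤ N := fun m => by
    rw [Int.abs_eq_natAbs]
    exact_mod_cast Finset.le_sup (f := fun m => (a m).natAbs) (Finset.mem_univ m)
  -- If `y = 0`, then `N = 0`, and division by zero gives the constant path `0`.
  let p : ℕ → Fin k → ℤ := fun j m => (j * a m) / (N : ℤ)
  have hpN : p N = a := by
    ext m
    rcases Nat.eq_zero_or_pos N with h | h
    · have := hN m
      rw [h] at this
      simp only [p, h]
      simp only [Nat.cast_zero, abs_nonpos_iff] at this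
      simp [this]
    · simp only [p]
      rw [Int.mul_ediv_cancel_left]
      exact_mod_cast h.ne'
  refine ⟨N, fun j => Multiplicative.ofAdd (p j), ?_, ?_, fun j => ?_, fun j hj i => ?_⟩
  · change Multiplicative.ofAdd (p 0) = 1
    have : p 0 = 0 := by ext m; simp [p]
    rw [this]; rfl
  · change Multiplicative.ofAdd (p N) = y
    rw [hpN]; rfl
  · refine (pi_norm_le_iff_of_nonneg zero_le_one).2 fun m => ?_
    rw [Int.norm_eq_abs]
    exact_mod_cast Int.abs_ediv_step_le (hN m) j
  · change ‖d.χ i (Multiplicative.ofAdd (p j))‖ ≤ _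
    rcases Nat.eq_zero_or_pos N with h | h
    · have hj0 : j = N := by omega
      have hy : Multiplicative.ofAdd (p j) = y := by rw [hj0, hpN]; rfl
      rw [hy]
      calc ‖d.χ i y‖ ≤ max 1 ‖d.χ i y‖ := le_max_right _ _
        _ ≤ _ := le_mul_of_one_le_left (by positivity) (Real.one_le_exp hσ0)
    have hNr : (0 : ℝ) < N := by exact_mod_cast h
    set t : ℝ := (j : ℝ) / N with ht
    have ht0 : 0 ≤ t := by positivity
    have ht1 : t ≤ 1 := by rw [ht, div_le_one hNr]; exact_mod_cast hj
    have hlog : d.logNorm i (p j) ≤ t * d.logNorm i a + σ := by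
      have : d.logNorm i (p j) = t * d.logNorm i a +
          ∑ m, ((p j m : ℝ) - t * a m) * d.logNorm i (Pi.single m 1) := by
        rw [logNorm_eq_sum d i (p j), logNorm_eq_sum d i a, Finset.mul_sum,
          ← Finset.sum_add_distrib]
        exact Finset.sum_congr rfl fun m _ => by ring
      rw [this]
      gcongr
      refine hσ i (fun m => (p j m : ℝ) - t * a m) fun m => ?_
      have e₁ : ((p j m : ℤ) : ℝ) * N ≤ j * a m := by
        exact_mod_cast Int.ediv_mul_le (j * a m) (b := (N : ℤ)) (by exact_mod_cast h.ne')
      have e₂ : (j * a m : ℝ) < ((p j m : ℤ) + 1) * N := by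
        exact_mod_cast Int.lt_ediv_add_one_mul_self (j * a m) (b := (N : ℤ))
          (by exact_mod_cast h)
      have e₃ : t * a m = j * a m / N := by rw [ht]; ring
      have e₄ : ((p j m : ℤ) : ℝ) ≤ t * a m := by rw [e₃, le_div_iff₀ hNr]; exact e₁
      have e₅ : t * a m ≤ (p j m : ℤ) + 1 := by rw [e₃, div_le_iff₀ hNr]; exact e₂.le
      rw [abs_le]
      constructor <;> linarith
    rw [norm_χ_eq_exp, toAdd_ofAdd]
    have hmax : t * d.logNorm i a ≤ max 0 (d.logNorm i a) := by
      rcases le_total 0 (d.logNorm i a) with h0 | h0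
      · exact (mul_le_of_le_one_left h0 ht1).trans (le_max_right _ _)
      · exact (mul_nonpos_of_nonneg_of_nonpos ht0 h0).trans (le_max_left _ _)
    calc Real.exp (d.logNorm i (p j)) ≤ Real.exp (σ + max 0 (d.logNorm i a)) := by
          rw [Real.exp_le_exp]; linarith
      _ = _ := by
        rw [Real.exp_add, Real.exp_monotone.map_max, Real.exp_zero, d.norm_χ_eq_exp i y]

/-- Modulo the image of `φ v - 1`, an integer vector has a representative that is bounded in terms
of its coordinates in the kernel of `φ v - 1` alone: the other coordinates are removed by an
approximate real solution of `(φ v - 1) η = x`. -/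
theorem exists_small_representative {v : Multiplicative (Fin k → ℤ)} {Q R : ℝ} (hQ : 0 ≤ Q)
    (hR : 0 ≤ R)
    (hv : ∀ i, ‖d.χ i v‖ ≤ Q) (x : Fin n → ℤ)
    (hx : ∀ i, d.χ i v = 1 → ‖d.intCoord x i‖ ≤ R) :
    ∃ η : Fin n → ℤ, ‖x - ((φ v).1.mulVec η - η)‖ ≤ d.bound * R + (d.bound ^ 2 * Q + 1) := by
  let ζ : Fin n → ℂ := fun i => d.intCoord x i / (d.χ i v - 1)
  let A := (φ v).1.map (Int.cast : ℤ → ℝ)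
  have hb := d.bound_pos
  let e : Fin n → ℝ := intVec n (d.lattice ζ) - d.recon ζ
  have he : ‖e‖ ≤ 1 := d.norm_intVec_lattice_sub_le ζ
  refine ⟨d.lattice ζ, ?_⟩
  have h : intVec n (x - ((φ v).1.mulVec (d.lattice ζ) - d.lattice ζ)) =
      d.recon (d.intCoord x - ((fun i => d.χ i v * ζ i) - ζ)) - (A.mulVec e - e) := by
    rw [map_sub, map_sub, intVec_mulVec, map_sub, map_sub, d.recon_mulVec, d.recon_intCoord,
      Matrix.mulVec_sub]
    simp only [A, e]
    abel
  rw [← norm_intVec, h]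
  refine (norm_sub_le _ _).trans (add_le_add ((d.norm_recon_le _).trans ?_)
    ((norm_sub_le _ _).trans (add_le_add ?_ he)))
  · gcongr
    refine (pi_norm_le_iff_of_nonneg hR).2 fun i => ?_
    by_cases hi : d.χ i v = 1
    · simpa [ζ, hi] using hx i hi
    · have : d.intCoord x i - (d.χ i v * ζ i - ζ i) = 0 := by
        have := sub_ne_zero.2 hi
        simp only [ζ]
        field_simp
        ring
      simp only [Pi.sub_apply]
      rw [this, norm_zero]
      exact hR
  · calc ‖A.mulVec e‖ ≤ d.bound ^ 2 * Q * ‖e‖ := d.norm_mulVec_le hQ hv e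
      _ ≤ d.bound ^ 2 * Q := mul_le_of_le_one_right (by positivity) he

/-- If `(φ v - 1) x = b` has an integer solution, it has one that is bounded polynomially in
terms of `φ v` and `b`. -/
theorem exists_solution_le {v : Multiplicative (Fin k → ℤ)} {Q M : ℝ} (hQ : 1 ≤ Q)
    (hM : 1 ≤ M) (hv : ∀ i, ‖d.χ i v‖ ≤ Q) {x b : Fin n → ℤ}
    (hx : (φ v).1.mulVec x - x = b) (hb : ∀ i, ‖d.intCoord b i‖ ≤ M) :
    ∃ x', (φ v).1.mulVec x' - x' = b ∧ ‖x'‖ ≤ d.bound ^ 2 * ((2 * Q) ^ n * M) := by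
  obtain ⟨D, P, hD, hDeq, hP⟩ := d.exists_kernel_projection v
  obtain ⟨x', hx', hc⟩ := d.exists_small_solution hD hP x
  have hbd := d.bound_pos
  have hb1 := d.one_le_bound
  refine ⟨x', hx'.trans hx, ?_⟩
  have hpow : (1 : ℝ) ≤ (2 * Q) ^ n := one_le_pow₀ (by linarith)
  have hfac : ∀ i, 0 ≤ (if d.χ i v = 1 then 1 else ‖d.χ i v - 1‖) ∧
      (if d.χ i v = 1 then 1 else ‖d.χ i v - 1‖) ≤ 2 * Q := by
    intro i
    split_ifs
    · constructor <;> linarith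
    · refine ⟨norm_nonneg _, (norm_sub_le _ _).trans ?_⟩
      rw [norm_one]
      linarith [hv i]
  have hDQ : (D : ℝ) ≤ (2 * Q) ^ n := by
    rw [hDeq]
    refine (Finset.prod_le_prod (fun i _ => (hfac i).1) fun i _ => (hfac i).2).trans ?_
    simp
  have hD1 : (1 : ℝ) ≤ D := by exact_mod_cast hD
  refine (d.norm_le_intCoord x').trans ?_
  rw [pow_two, mul_assoc]
  gcongr
  refine (pi_norm_le_iff_of_nonneg (by positivity)).2 fun i => ?_
  by_cases hi : d.χ i v = 1
  · refine ((hc i).2 hi).trans ?_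
    gcongr
    exact hDQ.trans (le_mul_of_one_le_right (by positivity) hM)
  · -- The factors of `1 ≤ D` other than `‖χ i v - 1‖` are at most `2 * Q`, which bounds
    -- `‖χ i v - 1‖` from below.
    refine le_trans ?_ (le_mul_of_one_le_left (by positivity) hb1)
    rw [(hc i).1 hi]
    have h₁ : 1 ≤ ‖d.χ i v - 1‖ * (2 * Q) ^ n := by
      rw [hDeq, ← Finset.mul_prod_erase _ _ (Finset.mem_univ i), if_neg hi] at hD1
      refine hD1.trans ?_
      gcongr
      refine (Finset.prod_le_prod (fun i _ => (hfac i).1) fun i _ => (hfac i).2).trans ?_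
      rw [Finset.prod_const]
      exact pow_le_pow_right₀ (by linarith) (by simp)
    calc ‖d.intCoord x i‖ ≤ ‖d.intCoord x i‖ * (‖d.χ i v - 1‖ * (2 * Q) ^ n) :=
          le_mul_of_one_le_right (norm_nonneg _) h₁
      _ = (2 * Q) ^ n * ‖d.intCoord b i‖ := by
          rw [← d.coord_eq_of_mulVec_sub hx i, norm_mul]; ring
      _ ≤ _ := by gcongr; exact hb i

end JointDiagonalization

end

/-! ### The exponential bound -/

section

variable {n k : ℕ} {φ : Multiplicative (Fin k → ℤ) →* Matrix.SpecialLinearGroup (Fin n) ℤ}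
  {S : Set (LatticeSemidirect φ)}

theorem exists_latticeElt_of_isConj {g h : LatticeSemidirect φ} (hc : IsConj g h) :
    ∃ u w x v y, g = latticeElt φ u v ∧ h = latticeElt φ w v ∧
      u + (φ v).1.mulVec x = x + (φ y).1.mulVec w := by
  obtain ⟨c, hc⟩ := isConj_iff.1 hc.symm
  obtain ⟨u, v, rfl⟩ := exists_eq_latticeElt g
  obtain ⟨w, v', rfl⟩ := exists_eq_latticeElt h
  obtain ⟨x, y, rfl⟩ := exists_eq_latticeElt c
  rw [mul_inv_eq_iff_eq_mul] at hc
  have hv : v = v' := by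
    have := congrArg (fun g : LatticeSemidirect φ => g.right) hc
    rw [SemidirectProduct.mul_right, SemidirectProduct.mul_right, mul_comm] at this
    exact (mul_right_cancel this).symm
  subst hv
  exact ⟨u, w, x, v, y, rfl, rfl, latticeElt_conj_iff.1 hc.symm⟩

/-- The elements `(a, v)` with `‖a‖ ≤ R`. -/
noncomputable def latticeBall
    (φ : Multiplicative (Fin k → ℤ) →* Matrix.SpecialLinearGroup (Fin n) ℤ)
    (v : Multiplicative (Fin k → ℤ)) (R : ℝ) : Finset (LatticeSemidirect φ) :=
  open Classical in
  (Fintype.piFinset fun _ : Fin n => Finset.Icc (-⌊R⌋) ⌊R⌋).image fun a => latticeElt φ a v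

theorem latticeElt_mem_latticeBall {v : Multiplicative (Fin k → ℤ)} {R : ℝ} {a : Fin n → ℤ}
    (ha : ‖a‖ ≤ R) : latticeElt φ a v ∈ latticeBall φ v R := by
  refine Finset.mem_image_of_mem _ (Fintype.mem_piFinset.2 fun j => Finset.mem_Icc.2 ?_)
  have h := (norm_le_pi_norm a j).trans ha
  rw [Int.norm_eq_abs, abs_le] at h
  refine ⟨?_, Int.le_floor.2 h.2⟩
  rw [neg_le, Int.le_floor]
  push_cast
  linarith [h.1]

theorem card_latticeBall_le (v : Multiplicative (Fin k → ℤ)) {R : ℝ} (hR : 0 ≤ R) :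
    ((latticeBall φ v R).card : ℝ) ≤ (2 * R + 1) ^ n := by
  classical
  refine (Nat.cast_le.2 Finset.card_image_le).trans ?_
  rw [Fintype.card_piFinset, Finset.prod_const, Finset.card_univ, Fintype.card_fin, Nat.cast_pow]
  gcongr
  have h0 : 0 ≤ ⌊R⌋ := Int.floor_nonneg.2 hR
  have h : ((Finset.Icc (-⌊R⌋) ⌊R⌋).card : ℤ) = ⌊R⌋ + 1 - -⌊R⌋ := by
    rw [Int.card_Icc, Int.toNat_of_nonneg (by linarith)]
  have h' : ((Finset.Icc (-⌊R⌋) ⌊R⌋).card : ℝ) = ((⌊R⌋ + 1 - -⌊R⌋ : ℤ) : ℝ) := by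
    exact_mod_cast h
  rw [h']
  push_cast
  linarith [Int.floor_le R]

namespace JointDiagonalization

/-- The conjugacy length is at most exponential. Between conjugate elements `(u, v)` and `(w, v)`
there is a chain of elements `(a, v)`, each conjugate to the next by a short element, which follows
the path of `exists_path`; along it `a` can be chosen at most exponentially large. -/
theorem exists_conj_wordLength_le_pow (d : JointDiagonalization φ) (hfin : S.Finite)
    (hgen : Subgroup.closure S = ⊤) :
    ∃ A : ℝ, 0 < A ∧ ∀ g h : LatticeSemidirect φ, IsConj g h →
      ∃ c : LatticeSemidirect φ, g * c = c * h ∧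
        (wordLength S c : ℝ) ≤ A ^ (wordLength S g + wordLength S h) := by
  obtain ⟨K, hK2, hK⟩ := d.exists_coord_le_wordLength hfin hgen
  obtain ⟨C, hC1, hCx, hCy⟩ := exists_wordLength_latticeElt_le hgen
  obtain ⟨κ, hκ1, hκs, hκ⟩ := d.exists_path
  set β := d.bound with hβ
  have hβ1 : 1 ≤ β := d.one_le_bound
  -- With `Q` exponential in the length, `c₁ * Q` bounds the vectors of the chain and
  -- `c₂ * Q ^ (n + 1)` the length of its steps.
  let c₁ : ℝ := β * κ + β ^ 2 + 1
  let c₂ : ℝ := C * (β ^ 2 * (2 ^ n * ((κ + 1) * β * c₁))) + C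
  let c₃ : ℝ := (2 * c₁ + 1) ^ n * c₂
  have hc₁ : 1 ≤ c₁ := by simp only [c₁]; nlinarith
  have hc₂ : 1 ≤ c₂ := hC1.trans (le_add_of_nonneg_left (by positivity))
  have hc₃ : 1 ≤ c₃ := by
    have : 1 ≤ (2 * c₁ + 1) ^ n := one_le_pow₀ (by linarith)
    simp only [c₃]; nlinarith
  refine ⟨c₃ * (K ^ 2) ^ (2 * n + 1), by positivity, fun g h hgh => ?_⟩
  by_cases hL : wordLength S g + wordLength S h = 0
  · refine ⟨1, ?_, by simp [hL]⟩
    rw [eq_one_of_wordLength_eq_zero hgen (Nat.add_eq_zero_iff.1 hL).1,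
      eq_one_of_wordLength_eq_zero hgen (Nat.add_eq_zero_iff.1 hL).2]
  obtain ⟨u, w, x₀, v, y, rfl, rfl, hconj⟩ := exists_latticeElt_of_isConj hgh
  set L := wordLength S (latticeElt φ u v) + wordLength S (latticeElt φ w v) with hLdef
  set Q : ℝ := (K ^ 2) ^ L with hQ
  have hQ1 : 1 ≤ Q := one_le_pow₀ (one_le_pow₀ (by linarith))
  have hv : ∀ i, ‖d.χ i v‖ ≤ Q := fun i => ((hK u v).2 i).1.trans <| by
    rw [hQ, ← pow_mul]
    exact pow_le_pow_right₀ (by linarith) (by omega)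
  have hu : ∀ i, ‖d.intCoord u i‖ ≤ Q := fun i => ((hK u v).2 i).2.1.trans <| by
    rw [hQ, ← pow_mul]
    exact pow_le_pow_right₀ (by linarith) (by omega)
  have hw : ∀ i, ‖d.intCoord w i‖ ≤ Q := fun i => ((hK w v).2 i).2.1.trans <| by
    rw [hQ, ← pow_mul]
    exact pow_le_pow_right₀ (by linarith) (by omega)
  set R : ℝ := c₁ * Q with hR
  have hR1 : 1 ≤ R := one_le_mul_of_one_le_of_one_le hc₁ hQ1
  have hsmall : ∀ a : Fin n → ℤ, (∀ i, ‖d.intCoord a i‖ ≤ Q) → ‖a‖ ≤ R := by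
    intro a ha
    refine (d.norm_le_intCoord a).trans ?_
    have h₁ : ‖d.intCoord a‖ ≤ Q := (pi_norm_le_iff_of_nonneg (by positivity)).2 ha
    have h₂ : β ≤ c₁ := by simp only [c₁]; nlinarith
    rw [← hβ, hR]
    gcongr
  set B₀ : ℝ := C * (β ^ 2 * ((2 * Q) ^ n * ((κ + 1) * β * R))) + C with hB₀
  -- A step of the chain: if `q` is conjugate to `p` by an element whose `ℤᵏ`-part is short, then
  -- its `ℤⁿ`-part solves a linear equation and so can be replaced by a short one.
  have hstep : ∀ (p q x : Fin n → ℤ) (s : Multiplicative (Fin k → ℤ)), ‖p‖ ≤ R → ‖q‖ ≤ R →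
      ‖Multiplicative.toAdd s‖ ≤ 1 → p + (φ v).1.mulVec x = x + (φ s).1.mulVec q →
      latticeElt φ p v ∈ latticeBall φ v R ∧ latticeElt φ q v ∈ latticeBall φ v R ∧
      ∃ c, latticeElt φ p v * c = c * latticeElt φ q v ∧ wordLength S c ≤ ⌊B₀⌋₊ := by
    intro p q x s hp hq hs hx
    refine ⟨latticeElt_mem_latticeBall hp, latticeElt_mem_latticeBall hq, ?_⟩
    have hx' : (φ v).1.mulVec x - x = (φ s).1.mulVec q - p := by
      rw [sub_eq_sub_iff_add_eq_add, add_comm, hx, add_comm]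
    obtain ⟨x', hx', hle⟩ := d.exists_solution_le (M := (κ + 1) * β * R) hQ1
      (one_le_mul_of_one_le_of_one_le
        (one_le_mul_of_one_le_of_one_le (by linarith) hβ1) hR1) hv hx' fun i => by
        rw [map_sub, Pi.sub_apply, d.intCoord_mulVec]
        have h₁ : ‖d.intCoord p i‖ ≤ β * R :=
          (norm_le_pi_norm _ i).trans ((d.norm_intCoord_le p).trans (by gcongr))
        have h₂ : ‖d.intCoord q i‖ ≤ β * R :=
          (norm_le_pi_norm _ i).trans ((d.norm_intCoord_le q).trans (by gcongr))
        calc _ ≤ ‖d.χ i s‖ * ‖d.intCoord q i‖ + ‖d.intCoord p i‖ := by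
              rw [← norm_mul]; exact norm_sub_le _ _
          _ ≤ κ * (β * R) + β * R := by
              have := hκs s hs i
              gcongr
          _ = _ := by ring
    refine ⟨latticeElt φ x' s, latticeElt_conj_iff.2 ?_, Nat.le_floor ?_⟩
    · rw [sub_eq_sub_iff_add_eq_add] at hx'
      rw [add_comm, hx', add_comm]
    · refine (hCy x' s).trans ?_
      rw [hB₀]
      gcongr
      · refine (hCx x').trans ?_
        gcongr
      · exact mul_le_of_le_one_right (by linarith) hs
  obtain ⟨N, p, hp0, hpN, hps, hp⟩ := hκ y
  have hpw : ∀ j ≤ N, ∃ η : Fin n → ℤ,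
      ‖(φ (p j)).1.mulVec w - ((φ v).1.mulVec η - η)‖ ≤ R := by
    intro j hj
    obtain ⟨η, hη⟩ := d.exists_small_representative (R := κ * Q) (by positivity) (by positivity)
      hv ((φ (p j)).1.mulVec w) fun i hi => by
        have hcu : d.χ i y * d.intCoord w i = d.intCoord u i := by
          have := congrFun (congrArg d.intCoord hconj) i
          rw [map_add, map_add, Pi.add_apply, Pi.add_apply, d.intCoord_mulVec, d.intCoord_mulVec,
            hi, one_mul, add_comm] at this
          exact (add_left_cancel this).symm
        rw [d.intCoord_mulVec, norm_mul]
        calc _ ≤ κ * max 1 ‖d.χ i y‖ * ‖d.intCoord w i‖ := by gcongr; exact hp j hj i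
          _ = κ * max ‖d.intCoord w i‖ ‖d.χ i y * d.intCoord w i‖ := by
              rw [mul_assoc, max_mul_of_nonneg _ _ (norm_nonneg _), one_mul, norm_mul]
          _ ≤ κ * Q := by
              gcongr
              rw [hcu]
              exact max_le (hw i) (hu i)
    refine ⟨η, hη.trans ?_⟩
    simp only [hR, c₁]
    nlinarith
  choose! η hη using hpw
  -- Consecutive points of the path differ by at most one, and so their representatives by one step.
  have hchain : ∀ j ≤ N, Relation.ReflTransGen (fun p q => p ∈ latticeBall φ v R ∧
      q ∈ latticeBall φ v R ∧ ∃ c, p * c = c * q ∧ wordLength S c ≤ ⌊B₀⌋₊)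
      (latticeElt φ ((φ (p j)).1.mulVec w - ((φ v).1.mulVec (η j) - η j)) v)
      (latticeElt φ w v) := by
    intro j
    induction j with
    | zero =>
      intro hj
      refine Relation.ReflTransGen.single (hstep _ _ (η 0) 1 (hη 0 hj) (hsmall w hw) (by simp) ?_)
      rw [hp0, one_mulVec]
      abel
    | succ j ih =>
      intro hj
      refine Relation.ReflTransGen.head (hstep _ _
        (η (j + 1) - (φ (p (j + 1) / p j)).1.mulVec (η j)) (p (j + 1) / p j) (hη _ hj)
        (hη j (by omega)) (hps j) ?_) (ih (by omega))
      apply d.intCoord_injective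
      ext i
      have : d.χ i (p (j + 1)) = d.χ i (p (j + 1) / p j) * d.χ i (p j) := by
        rw [← map_mul, div_mul_cancel]
      simp only [map_sub, map_add, Pi.sub_apply, Pi.add_apply, d.intCoord_mulVec, this]
      ring
  have hfirst := hstep u _ (x₀ - η N) 1 (hsmall u hu) (hη N le_rfl) (by simp) (by
    rw [one_mulVec, hpN, Matrix.mulVec_sub, eq_sub_of_add_eq hconj]
    abel)
  obtain ⟨c, hc, hcl⟩ := exists_conj_wordLength_le_of_chain hgen _ _
    (Relation.ReflTransGen.head hfirst (hchain N le_rfl))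
  refine ⟨c, hc, ?_⟩
  calc (wordLength S c : ℝ) ≤ (latticeBall φ v R).card * (⌊B₀⌋₊ : ℝ) := by exact_mod_cast hcl
    _ ≤ (2 * R + 1) ^ n * B₀ := by
        gcongr
        · exact card_latticeBall_le v (by linarith)
        · exact Nat.floor_le (by positivity)
    _ ≤ ((2 * c₁ + 1) * Q) ^ n * (c₂ * Q ^ (n + 1)) := by
        have h₁ : 2 * R + 1 ≤ (2 * c₁ + 1) * Q := by rw [hR]; linarith
        have h₂ : B₀ ≤ c₂ * Q ^ (n + 1) := by
          have : 1 ≤ Q ^ (n + 1) := one_le_pow₀ hQ1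
          have h₃ : B₀ = C * (β ^ 2 * (2 ^ n * ((κ + 1) * β * c₁))) * Q ^ (n + 1) + C := by
            rw [hB₀, hR]; ring
          rw [h₃]
          have h₄ : C ≤ C * Q ^ (n + 1) := le_mul_of_one_le_right (by linarith) this
          simp only [c₂]
          rw [add_mul _ C]
          linarith
        gcongr
    _ = c₃ * Q ^ (2 * n + 1) := by
        rw [mul_pow]; simp only [c₃]; ring
    _ ≤ c₃ ^ L * Q ^ (2 * n + 1) := by
        gcongr
        exact le_self_pow₀ hc₃ hL
    _ = _ := by
        rw [mul_pow c₃, hQ, ← pow_mul, ← pow_mul (K ^ 2), mul_comm L]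

end JointDiagonalization

end

/-! ### Short words for integer vectors -/

section

variable {n k : ℕ} {φ : Multiplicative (Fin k → ℤ) →* Matrix.SpecialLinearGroup (Fin n) ℤ}
  {S : Set (LatticeSemidirect φ)}

theorem wordLength_latticeElt_add_le (hgen : Subgroup.closure S = ⊤) (a b : Fin n → ℤ) :
    wordLength S (latticeElt φ (a + b) 1) ≤
      wordLength S (latticeElt φ a 1) + wordLength S (latticeElt φ b 1) := by
  have h : latticeElt φ (a + b) 1 = latticeElt φ a 1 * latticeElt φ b 1 := by
    rw [latticeElt_mul, one_mulVec, one_mul]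
  rw [h]
  exact wordLength_mul_le hgen _ _

theorem wordLength_latticeElt_mulVec_le (hgen : Subgroup.closure S = ⊤) (a : Fin n → ℤ)
    (s : Multiplicative (Fin k → ℤ)) :
    wordLength S (latticeElt φ ((φ s).1.mulVec a) 1) ≤
      wordLength S (latticeElt φ a 1) + 2 * wordLength S (latticeElt φ 0 s) := by
  have h : latticeElt φ ((φ s).1.mulVec a) 1 =
      latticeElt φ 0 s * latticeElt φ a 1 * (latticeElt φ 0 s)⁻¹ := by
    rw [eq_mul_inv_iff_mul_eq, latticeElt_mul, latticeElt_mul]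
    simp
  rw [h]
  have h₁ := wordLength_mul_le hgen (latticeElt φ 0 s * latticeElt φ a 1) (latticeElt φ 0 s)⁻¹
  have h₂ := wordLength_mul_le hgen (latticeElt φ 0 s) (latticeElt φ a 1)
  have h₃ := wordLength_inv_le hgen (latticeElt φ 0 s)
  omega

namespace JointDiagonalization

variable (d : JointDiagonalization φ)

/-- The part of an integer vector `x` in the eigendirections expanded by `φ s`, moved to the nearest
integer vector, has word length logarithmic in its size: rounding the `φ s ^ (-j)`-translates of
this part gives integer vectors `a j`, eventually bounded, with `a j - φ s (a (j + 1))` bounded. -/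
theorem exists_wordLength_expanding_le (hgen : Subgroup.closure S = ⊤)
    (s : Multiplicative (Fin k → ℤ)) {ρ : ℝ} (hρ : 1 < ρ) :
    ∃ C : ℝ, 0 ≤ C ∧ ∀ (x : Fin n → ℤ) (J : ℕ),
      (∀ i, ρ ≤ ‖d.χ i s‖ → ‖d.intCoord x i‖ ≤ ρ ^ J) →
      (wordLength S (latticeElt φ
        (d.lattice fun i => if ρ ≤ ‖d.χ i s‖ then d.intCoord x i else 0) 1) : ℝ) ≤
          C * (J + 1) := by
  obtain ⟨C₀, hC1, hCx, -⟩ := exists_wordLength_latticeElt_le hgen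
  have hb := d.bound_pos
  let M : ℝ := ∑ i, ‖d.χ i s‖
  have hM0 : 0 ≤ M := by positivity
  have hM : ∀ i, ‖d.χ i s‖ ≤ M := fun i =>
    Finset.single_le_sum (f := fun i => ‖d.χ i s‖) (fun i _ => norm_nonneg _) (Finset.mem_univ i)
  set E : ℝ := C₀ * (1 + d.bound ^ 2 * M) + 2 * wordLength S (latticeElt φ 0 s) with hE
  refine ⟨E + C₀ * (1 + d.bound), by positivity, fun x J hx => ?_⟩
  let z : ℕ → Fin n → ℂ := fun j i =>
    if ρ ≤ ‖d.χ i s‖ then (d.χ i s)⁻¹ ^ j * d.intCoord x i else 0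
  let a : ℕ → Fin n → ℤ := fun j => d.lattice (z j)
  have hz : ∀ j, z j = fun i => d.χ i s * z (j + 1) i := by
    intro j
    ext i
    simp only [z]
    split_ifs
    · rw [pow_succ', ← mul_assoc, ← mul_assoc, mul_inv_cancel₀ (d.χ_ne_zero i s), one_mul]
    · simp
  have hdiff : ∀ j, ‖a j - (φ s).1.mulVec (a (j + 1))‖ ≤ 1 + d.bound ^ 2 * M := by
    intro j
    have h : intVec n (a j - (φ s).1.mulVec (a (j + 1))) =
        (intVec n (a j) - d.recon (z j)) - ((φ s).1.map (Int.cast : ℤ → ℝ)).mulVec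
          (intVec n (a (j + 1)) - d.recon (z (j + 1))) := by
      rw [map_sub, intVec_mulVec, Matrix.mulVec_sub, ← d.recon_mulVec, ← hz]
      abel
    rw [← norm_intVec, h]
    refine (norm_sub_le _ _).trans (add_le_add (d.norm_intVec_lattice_sub_le _) ?_)
    exact (d.norm_mulVec_le hM0 hM _).trans
      (mul_le_of_le_one_right (by positivity) (d.norm_intVec_lattice_sub_le _))
  have hstep : ∀ j, (wordLength S (latticeElt φ (a j) 1) : ℝ) ≤
      E + wordLength S (latticeElt φ (a (j + 1)) 1) := by
    intro j
    have h₁ := wordLength_latticeElt_add_le hgen (a j - (φ s).1.mulVec (a (j + 1)))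
      ((φ s).1.mulVec (a (j + 1)))
    rw [sub_add_cancel] at h₁
    have h₂ := wordLength_latticeElt_mulVec_le hgen (a (j + 1)) s
    have h₃ : (wordLength S (latticeElt φ (a j) 1) : ℝ) ≤
        wordLength S (latticeElt φ (a j - (φ s).1.mulVec (a (j + 1))) 1) +
          (wordLength S (latticeElt φ (a (j + 1)) 1) + 2 * wordLength S (latticeElt φ 0 s)) := by
      exact_mod_cast h₁.trans (by gcongr)
    have h₄ : C₀ * ‖a j - (φ s).1.mulVec (a (j + 1))‖ ≤ C₀ * (1 + d.bound ^ 2 * M) := by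
      gcongr
      exact hdiff j
    linarith [hCx (a j - (φ s).1.mulVec (a (j + 1)))]
  have hsum : ∀ j : ℕ, (wordLength S (latticeElt φ (a 0) 1) : ℝ) ≤
      j * E + wordLength S (latticeElt φ (a j) 1) := by
    intro j
    induction j with
    | zero => simp
    | succ j ih =>
      push_cast
      linarith [hstep j]
  have hend : (wordLength S (latticeElt φ (a J) 1) : ℝ) ≤ C₀ * (1 + d.bound) := by
    refine (hCx _).trans ?_
    gcongr
    refine (d.norm_lattice_le _).trans ?_
    gcongr
    refine mul_le_of_le_one_right hb.le ((pi_norm_le_iff_of_nonneg zero_le_one).2 fun i => ?_)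
    simp only [z]
    split_ifs with hi
    · rw [norm_mul, norm_pow, norm_inv, inv_pow, inv_mul_le_iff₀ (pow_pos (d.norm_χ_pos i s) J),
        mul_one]
      exact (hx i hi).trans (pow_le_pow_left₀ (by linarith) hi J)
    · simp
  have h0 : (d.lattice fun i => if ρ ≤ ‖d.χ i s‖ then d.intCoord x i else 0) = a 0 := by
    simp [a, z]
  rw [h0]
  have hE0 : 0 ≤ E := by positivity
  have hJ : (0 : ℝ) ≤ J := by positivity
  have hp : 0 ≤ C₀ * (1 + d.bound) := by positivity
  nlinarith [hsum J, mul_nonneg hp hJ]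

/-- The word length of an integer vector is bounded logarithmically in the coordinates that `φ s`
expands or contracts, and linearly in those that it preserves. -/
theorem exists_wordLength_le_hyperbolic (hgen : Subgroup.closure S = ⊤)
    (s : Multiplicative (Fin k → ℤ)) {ρ : ℝ} (hρ : 1 < ρ)
    (hs : ∀ i, ‖d.χ i s‖ = 1 ∨ ρ ≤ ‖d.χ i s‖ ∨ ρ ≤ ‖d.χ i s‖⁻¹) :
    ∃ C : ℝ, 0 ≤ C ∧ ∀ (x : Fin n → ℤ) (J : ℕ) (M : ℝ), 0 ≤ M →
      (∀ i, ‖d.χ i s‖ ≠ 1 → ‖d.intCoord x i‖ ≤ ρ ^ J) →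
      (∀ i, ‖d.χ i s‖ = 1 → ‖d.intCoord x i‖ ≤ M) →
      (wordLength S (latticeElt φ x 1) : ℝ) ≤ C * (J + 1 + M) := by
  obtain ⟨C₀, hC1, hCx, -⟩ := exists_wordLength_latticeElt_le hgen
  obtain ⟨C₁, hC₁, h₁⟩ := d.exists_wordLength_expanding_le hgen s hρ
  obtain ⟨C₂, hC₂, h₂⟩ := d.exists_wordLength_expanding_le hgen s⁻¹ hρ
  have hb := d.bound_pos
  have hinv : ∀ i, ‖d.χ i s⁻¹‖ = ‖d.χ i s‖⁻¹ := fun i => by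
    rw [← norm_inv]
    congr 1
    refine eq_inv_of_mul_eq_one_left ?_
    rw [← map_mul, inv_mul_cancel, map_one]
  refine ⟨C₁ + C₂ + C₀ * (d.bound + 2), by positivity, fun x J M hM hx₁ hx₂ => ?_⟩
  set z₁ : Fin n → ℂ := fun i => if ρ ≤ ‖d.χ i s‖ then d.intCoord x i else 0 with hz₁
  set z₂ : Fin n → ℂ := fun i => if ρ ≤ ‖d.χ i s⁻¹‖ then d.intCoord x i else 0 with hz₂
  have e₁ := h₁ x J fun i hi => hx₁ i (by linarith)
  have e₂ := h₂ x J fun i hi => hx₁ i fun h => by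
    rw [hinv, h, inv_one] at hi
    linarith
  have hr : ‖x - d.lattice z₁ - d.lattice z₂‖ ≤ d.bound * M + 1 + 1 := by
    have h : intVec n (x - d.lattice z₁ - d.lattice z₂) =
        d.recon (d.intCoord x - z₁ - z₂) - (intVec n (d.lattice z₁) - d.recon z₁) -
          (intVec n (d.lattice z₂) - d.recon z₂) := by
      simp only [map_sub, d.recon_intCoord]
      abel
    rw [← norm_intVec, h]
    refine (norm_sub_le _ _).trans (add_le_add ((norm_sub_le _ _).trans
      (add_le_add ((d.norm_recon_le _).trans ?_) (d.norm_intVec_lattice_sub_le _)))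
      (d.norm_intVec_lattice_sub_le _))
    gcongr
    refine (pi_norm_le_iff_of_nonneg hM).2 fun i => ?_
    simp only [Pi.sub_apply, hz₁, hz₂, hinv]
    rcases hs i with hi | hi | hi
    · have h₁ : ¬ ρ ≤ ‖d.χ i s‖ := by linarith
      have h₂ : ¬ ρ ≤ ‖d.χ i s‖⁻¹ := by rw [hi, inv_one]; linarith
      simpa [h₁, h₂] using hx₂ i hi
    · have : ‖d.χ i s‖⁻¹ < 1 := inv_lt_one_of_one_lt₀ (by linarith)
      have h₂ : ¬ ρ ≤ ‖d.χ i s‖⁻¹ := by linarith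
      simpa [hi, h₂] using hM
    · have : ‖d.χ i s‖⁻¹⁻¹ < 1 := inv_lt_one_of_one_lt₀ (by linarith)
      rw [inv_inv] at this
      have h₁ : ¬ ρ ≤ ‖d.χ i s‖ := by linarith
      simpa [hi, h₁] using hM
  have hsum : wordLength S (latticeElt φ x 1) ≤
      wordLength S (latticeElt φ (d.lattice z₁) 1) + (wordLength S (latticeElt φ (d.lattice z₂) 1) +
        wordLength S (latticeElt φ (x - d.lattice z₁ - d.lattice z₂) 1)) := by
    have hx : x = d.lattice z₁ + (d.lattice z₂ + (x - d.lattice z₁ - d.lattice z₂)) := by abel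
    conv_lhs => rw [hx]
    exact (wordLength_latticeElt_add_le hgen _ _).trans
      (Nat.add_le_add_left (wordLength_latticeElt_add_le hgen _ _) _)
  have hsum' : (wordLength S (latticeElt φ x 1) : ℝ) ≤
      wordLength S (latticeElt φ (d.lattice z₁) 1) + (wordLength S (latticeElt φ (d.lattice z₂) 1) +
        wordLength S (latticeElt φ (x - d.lattice z₁ - d.lattice z₂) 1)) := by
    exact_mod_cast hsum
  have e₃ : (wordLength S (latticeElt φ (x - d.lattice z₁ - d.lattice z₂) 1) : ℝ) ≤
      C₀ * (d.bound + 2) * (J + 1 + M) := by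
    refine (hCx _).trans ?_
    rw [mul_assoc]
    gcongr
    have hJ : (0 : ℝ) ≤ J := by positivity
    nlinarith
  have e₁' : C₁ * ((J : ℝ) + 1) ≤ C₁ * (J + 1 + M) :=
    mul_le_mul_of_nonneg_left (by linarith) hC₁
  have e₂' : C₂ * ((J : ℝ) + 1) ≤ C₂ * (J + 1 + M) :=
    mul_le_mul_of_nonneg_left (by linarith) hC₂
  rw [add_mul, add_mul]
  linarith

end JointDiagonalization

end

/-! ### The linear bound for cyclic actions -/

theorem exists_one_lt_le_norm_or_inv {ι : Type*} [Finite ι] (a : ι → ℝ) (ha : ∀ i, 0 < a i) :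
    ∃ ρ : ℝ, 1 < ρ ∧ ∀ i, a i = 1 ∨ ρ ≤ a i ∨ ρ ≤ (a i)⁻¹ := by
  have h : ∀ i, ∀ᶠ ρ in nhdsWithin (1 : ℝ) (Set.Ioi 1), a i = 1 ∨ ρ ≤ a i ∨ ρ ≤ (a i)⁻¹ := by
    intro i
    have key : ∀ b : ℝ, 1 < b → ∀ᶠ ρ in nhdsWithin (1 : ℝ) (Set.Ioi 1), ρ ≤ b := fun b hb =>
      (eventually_le_nhds hb).filter_mono nhdsWithin_le_nhds
    rcases lt_trichotomy (a i) 1 with h | h | h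
    · exact (key _ ((one_lt_inv₀ (ha i)).2 h)).mono fun _ h => Or.inr (Or.inr h)
    · exact Filter.Eventually.of_forall fun _ => Or.inl h
    · exact (key _ h).mono fun _ h => Or.inr (Or.inl h)
  obtain ⟨ρ, h₁, h₂⟩ := ((Filter.eventually_all.2 h).and self_mem_nhdsWithin).exists
  exact ⟨ρ, h₂, h₁⟩

theorem norm_inv_zpow_sub_one_le {z : ℂ} {ρ : ℝ} (hρ : 1 < ρ) (hz : ρ ≤ ‖z‖) {q : ℤ}
    (hq : q ≠ 0) : ‖(z ^ q - 1)⁻¹‖ ≤ (1 - ρ⁻¹)⁻¹ := by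
  have hρ' : ρ⁻¹ < 1 := inv_lt_one_of_one_lt₀ hρ
  have h1 : 1 ≤ ‖z‖ := by linarith
  rw [norm_inv]
  refine inv_anti₀ (by linarith) ?_
  rcases lt_or_gt_of_ne hq with h | h
  · have h₁ : ‖z ^ q‖ ≤ ρ⁻¹ := by
      rw [norm_zpow]
      calc ‖z‖ ^ q ≤ ‖z‖ ^ (-1 : ℤ) := zpow_le_zpow_right₀ h1 (by omega)
        _ = ‖z‖⁻¹ := zpow_neg_one _
        _ ≤ ρ⁻¹ := inv_anti₀ (by linarith) hz
    have h₂ := norm_sub_norm_le 1 (z ^ q)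
    rw [norm_one, norm_sub_rev] at h₂
    linarith
  · have h₁ : ρ ≤ ‖z ^ q‖ := by
      rw [norm_zpow]
      calc ρ ≤ ‖z‖ ^ (1 : ℤ) := by rwa [zpow_one]
        _ ≤ _ := zpow_le_zpow_right₀ h1 (by omega)
    have h₂ := norm_sub_norm_le (z ^ q) 1
    rw [norm_one] at h₂
    have h₃ : 1 - ρ⁻¹ ≤ ρ - 1 := by
      have : 2 ≤ ρ + ρ⁻¹ := by
        have : ρ * ρ⁻¹ = 1 := mul_inv_cancel₀ (by linarith)
        nlinarith [sq_nonneg (ρ - 1), sq_nonneg (1 - ρ⁻¹)]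
      linarith
    linarith

/-- A nonzero complex number that is a root of unity if it has modulus one has powers that, when
different from one, stay away from one. (Where `z ^ q = 1`, the inverse is zero.) -/
theorem exists_norm_inv_zpow_sub_one_le {z : ℂ} (hz : z ≠ 0) {N : ℕ} (hN : 0 < N)
    (hzN : ‖z‖ = 1 → z ^ N = 1) :
    ∃ C : ℝ, 0 ≤ C ∧ ∀ q : ℤ, q ≠ 0 → ‖(z ^ q - 1)⁻¹‖ ≤ C := by
  obtain ⟨ρ, hρ, h⟩ := exists_one_lt_le_norm_or_inv (fun _ : Unit => ‖z‖)
    fun _ => norm_pos_iff.2 hz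
  have hC : 0 ≤ (1 - ρ⁻¹)⁻¹ := inv_nonneg.2 (by linarith [inv_lt_one_of_one_lt₀ hρ])
  rcases h () with h | h | h
  · refine ⟨∑ r ∈ Finset.range N, ‖(z ^ r - 1)⁻¹‖, by positivity, fun q _ => ?_⟩
    have hN' : (0 : ℤ) < N := by exact_mod_cast hN
    have hr0 := Int.emod_nonneg q hN'.ne'
    have hr1 := Int.emod_lt_of_pos q hN'
    have hq : z ^ q = z ^ (q % N).toNat := by
      conv_lhs => rw [← Int.emod_add_mul_ediv q N]
      rw [zpow_add₀ hz, zpow_mul, zpow_natCast, hzN h, one_zpow, mul_one, ← zpow_natCast,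
        Int.toNat_of_nonneg hr0]
    rw [hq]
    exact Finset.single_le_sum (f := fun r => ‖(z ^ r - 1)⁻¹‖) (fun _ _ => norm_nonneg _)
      (Finset.mem_range.2 (by omega))
  · exact ⟨_, hC, fun q hq => norm_inv_zpow_sub_one_le hρ h hq⟩
  · refine ⟨_, hC, fun q hq => ?_⟩
    have := norm_inv_zpow_sub_one_le hρ (z := z⁻¹) (by rwa [norm_inv]) (neg_ne_zero.2 hq)
    rwa [inv_zpow', neg_neg] at this

section

variable {n k : ℕ} {φ : Multiplicative (Fin k → ℤ) →* Matrix.SpecialLinearGroup (Fin n) ℤ}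
  {S : Set (LatticeSemidirect φ)}

namespace JointDiagonalization

/-- As the projection of `exists_kernel_projection` depends only on the set of characters that are
trivial on `v`, its denominator can be bounded independently of `v`. -/
theorem exists_uniform_kernel_projection (d : JointDiagonalization φ) :
    ∃ D₀ : ℤ, ∀ v, ∃ (D : ℤ) (P : Matrix (Fin n) (Fin n) ℤ), 0 < D ∧ D ≤ D₀ ∧
      ∀ x i, d.intCoord (P.mulVec x) i = if d.χ i v = 1 then (D : ℂ) * d.intCoord x i else 0 := by
  classical
  have h : ∀ I : Finset (Fin n), ∃ D₀ : ℤ, 0 ≤ D₀ ∧ ∀ v, (∀ i, i ∈ I ↔ d.χ i v = 1) →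
      ∃ (D : ℤ) (P : Matrix (Fin n) (Fin n) ℤ), 0 < D ∧ D ≤ D₀ ∧
        ∀ x i, d.intCoord (P.mulVec x) i =
          if d.χ i v = 1 then (D : ℂ) * d.intCoord x i else 0 := by
    intro I
    by_cases hI : ∃ v, ∀ i, i ∈ I ↔ d.χ i v = 1
    · obtain ⟨v, hv⟩ := hI
      obtain ⟨D, P, hD, -, hP⟩ := d.exists_kernel_projection v
      refine ⟨D, hD.le, fun v' hv' => ⟨D, P, hD, le_rfl, fun x i => ?_⟩⟩
      rw [hP]
      exact if_congr ((hv i).symm.trans (hv' i)) rfl rfl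
    · exact ⟨0, le_rfl, fun v hv => absurd ⟨v, hv⟩ hI⟩
  choose f hf0 hf using h
  refine ⟨∑ I, f I, fun v => ?_⟩
  obtain ⟨D, P, hD, hle, hP⟩ := hf (Finset.univ.filter fun i => d.χ i v = 1) v (by simp)
  exact ⟨D, P, hD, hle.trans (Finset.single_le_sum (fun I _ => hf0 I) (Finset.mem_univ _)), hP⟩

/-- If `w` and `u = φ s ^ y w` are both of size at most `ρ ^ J` and `y` is much larger than `J`,
then `w` has no component in the directions expanded or contracted by `φ s`: halfway between `w`
and `u` this component is tiny, but a fixed multiple of it is an integer vector. -/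
theorem exists_le_or_forall_coord_eq_zero (d : JointDiagonalization φ)
    (s : Multiplicative (Fin k → ℤ)) {ρ : ℝ} (hρ : 1 < ρ)
    (hs : ∀ i, ‖d.χ i s‖ = 1 ∨ ρ ≤ ‖d.χ i s‖ ∨ ρ ≤ ‖d.χ i s‖⁻¹)
    {N : ℕ} (hN : 0 < N) (hsN : ∀ i, ‖d.χ i s‖ = 1 → d.χ i s ^ N = 1) :
    ∃ E : ℕ, ∀ (y J : ℕ) (u w : Fin n → ℤ), u = (φ (s ^ y)).1.mulVec w →
      (∀ i, ‖d.intCoord u i‖ ≤ ρ ^ J) → (∀ i, ‖d.intCoord w i‖ ≤ ρ ^ J) →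
      y ≤ 2 * J + E ∨ ∀ i, ‖d.χ i s‖ ≠ 1 → d.intCoord w i = 0 := by
  obtain ⟨D, P, hD, -, hP⟩ := d.exists_kernel_projection (s ^ N)
  have hb := d.bound_pos
  have hDr : (0 : ℝ) < D := by exact_mod_cast hD
  have hsN' : ∀ i, d.χ i (s ^ N) = 1 ↔ ‖d.χ i s‖ = 1 := fun i => by
    rw [map_pow]
    refine ⟨fun h => ?_, hsN i⟩
    have := congrArg norm h
    rw [norm_pow, norm_one] at this
    exact (pow_eq_one_iff_of_nonneg (norm_nonneg _) hN.ne').1 this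
  obtain ⟨E, hE⟩ := pow_unbounded_of_one_lt (d.bound * D) hρ
  refine ⟨2 * E + 1, fun y J u w hu hcu hcw => ?_⟩
  by_cases hy : y ≤ 2 * J + (2 * E + 1)
  · exact Or.inl hy
  right
  set m := y / 2 with hm
  -- This is `D` times the part of `φ s ^ m w` in the expanded and contracted directions.
  let z : Fin n → ℤ := D • (φ (s ^ m)).1.mulVec w - P.mulVec ((φ (s ^ m)).1.mulVec w)
  have hz : ∀ i, d.intCoord z i =
      if ‖d.χ i s‖ = 1 then 0 else D * (d.χ i s ^ m * d.intCoord w i) := by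
    intro i
    simp only [z]
    rw [map_sub, Pi.sub_apply, map_zsmul, Pi.smul_apply, hP, d.intCoord_mulVec,
      map_pow (d.χ i) s m, zsmul_eq_mul]
    simp only [hsN']
    split_ifs <;> simp
  have hhyp : ∀ i, ‖d.χ i s‖ ≠ 1 → ‖d.χ i s ^ m * d.intCoord w i‖ * ρ ^ m ≤ ρ ^ J := by
    intro i hi
    have hpos := d.norm_χ_pos i s
    rw [norm_mul, norm_pow]
    rcases (hs i).resolve_left hi with h | h
    · have h₁ : ρ ^ m ≤ ‖d.χ i s‖ ^ (y - m) := calc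
        ρ ^ m ≤ ‖d.χ i s‖ ^ m := pow_le_pow_left₀ (by linarith) h m
        _ ≤ _ := pow_le_pow_right₀ (by linarith) (by omega)
      calc ‖d.χ i s‖ ^ m * ‖d.intCoord w i‖ * ρ ^ m
          ≤ ‖d.χ i s‖ ^ m * ‖d.intCoord w i‖ * ‖d.χ i s‖ ^ (y - m) := by gcongr
        _ = ‖d.χ i s‖ ^ (m + (y - m)) * ‖d.intCoord w i‖ := by rw [pow_add]; ring
        _ = ‖d.intCoord u i‖ := by
          rw [Nat.add_sub_cancel' (by omega), hu, d.intCoord_mulVec, map_pow, norm_mul, norm_pow]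
        _ ≤ _ := hcu i
    · have h₁ : ‖d.χ i s‖ * ρ ≤ 1 := by
        calc ‖d.χ i s‖ * ρ ≤ ‖d.χ i s‖ * ‖d.χ i s‖⁻¹ := by gcongr
          _ = 1 := mul_inv_cancel₀ hpos.ne'
      calc ‖d.χ i s‖ ^ m * ‖d.intCoord w i‖ * ρ ^ m
          = (‖d.χ i s‖ * ρ) ^ m * ‖d.intCoord w i‖ := by rw [mul_pow]; ring
        _ ≤ ‖d.intCoord w i‖ :=
          mul_le_of_le_one_left (norm_nonneg _) (pow_le_one₀ (by positivity) h₁)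
        _ ≤ _ := hcw i
  have hρm : 0 < ρ ^ m := by positivity
  have hz1 : ‖z‖ < 1 := by
    have h₁ : ‖d.intCoord z‖ ≤ D * ρ ^ J / ρ ^ m := by
      refine (pi_norm_le_iff_of_nonneg (by positivity)).2 fun i => ?_
      rw [hz]
      split_ifs with hi
      · rw [norm_zero]; positivity
      · rw [le_div_iff₀ hρm, norm_mul, Complex.norm_intCast, abs_of_pos hDr, mul_assoc]
        gcongr
        exact hhyp i hi
    calc ‖z‖ ≤ d.bound * (D * ρ ^ J / ρ ^ m) := (d.norm_le_intCoord z).trans (by gcongr)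
      _ = d.bound * D * ρ ^ J / ρ ^ m := by ring
      _ < 1 := by
        rw [div_lt_one hρm]
        calc d.bound * D * ρ ^ J < ρ ^ E * ρ ^ J := by gcongr
          _ = ρ ^ (E + J) := (pow_add _ _ _).symm
          _ ≤ ρ ^ m := pow_le_pow_right₀ hρ.le (by omega)
  have hz0 : z = 0 := by
    ext j
    have := (norm_le_pi_norm z j).trans_lt hz1
    rw [Int.norm_eq_abs] at this
    exact Int.abs_lt_one_iff.1 (by exact_mod_cast this)
  intro i hi
  have := hz i
  rw [hz0, map_zero, Pi.zero_apply, if_neg hi, eq_comm] at this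
  have hDc : (D : ℂ) ≠ 0 := by exact_mod_cast hD.ne'
  simpa [hDc, d.χ_ne_zero] using this

end JointDiagonalization

end

section

theorem zpow_emod_of_pow_eq_one {z : ℂ} (hz : z ≠ 0) {N : ℕ} (hzN : z ^ N = 1) (b : ℤ) :
    z ^ (b % N) = z ^ b := by
  conv_rhs => rw [← Int.emod_add_mul_ediv b N]
  rw [zpow_add₀ hz, zpow_mul, zpow_natCast, hzN, one_zpow, mul_one]

theorem exists_zpow_ofAdd_one_eq (y : Multiplicative (Fin 1 → ℤ)) :
    ∃ b : ℤ, y = Multiplicative.ofAdd (1 : Fin 1 → ℤ) ^ b := by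
  refine ⟨Multiplicative.toAdd y 0, Multiplicative.toAdd.injective ?_⟩
  ext i
  fin_cases i
  simp

theorem norm_toAdd_ofAdd_one_zpow (b : ℤ) :
    ‖Multiplicative.toAdd (Multiplicative.ofAdd (1 : Fin 1 → ℤ) ^ b)‖ = |(b : ℝ)| := by
  have h : Multiplicative.toAdd (Multiplicative.ofAdd (1 : Fin 1 → ℤ) ^ b) = fun _ => b := by
    ext i
    simp
  rw [h, pi_norm_const, Int.norm_eq_abs]

variable {n : ℕ} {φ : Multiplicative (Fin 1 → ℤ) →* Matrix.SpecialLinearGroup (Fin n) ℤ}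
  {S : Set (LatticeSemidirect φ)}

namespace JointDiagonalization

/-- The conjugacy length is at most linear for a cyclic action whose unimodular eigenvalues are
roots of unity. If the `ℤ`-part of the conjugate elements is nonzero, the `ℤ`-part of the
conjugator can be reduced modulo it, and the `ℤⁿ`-part is then a small solution of a linear
equation, the directions of the unimodular eigenvalues included. If it is zero, the `ℤ`-part of the
conjugator is bounded by `exists_le_or_forall_coord_eq_zero`, or can be reduced modulo the orders
of the roots of unity. -/
theorem exists_conj_wordLength_le_mul (d : JointDiagonalization φ) (hfin : S.Finite)
    (hgen : Subgroup.closure S = ⊤) (htor : ∀ v, UnimodularEigenvaluesTorsion (φ v)) :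
    ∃ B : ℝ, 0 < B ∧ ∀ g h : LatticeSemidirect φ, IsConj g h →
      ∃ c : LatticeSemidirect φ, g * c = c * h ∧
        (wordLength S c : ℝ) ≤ B * ((wordLength S g : ℝ) + (wordLength S h : ℝ)) := by
  set t : Multiplicative (Fin 1 → ℤ) := Multiplicative.ofAdd 1 with ht
  obtain ⟨K, hK2, hK⟩ := d.exists_coord_le_wordLength hfin hgen
  obtain ⟨C, hC1, hCx, hCy⟩ := exists_wordLength_latticeElt_le hgen
  obtain ⟨ρ, hρ, hs⟩ := exists_one_lt_le_norm_or_inv (fun i => ‖d.χ i t‖)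
    fun i => d.norm_χ_pos i t
  obtain ⟨N, hN, hsN⟩ : ∃ N : ℕ, 0 < N ∧ ∀ i, ‖d.χ i t‖ = 1 → d.χ i t ^ N = 1 := by
    have h : ∀ i, ∃ m : ℕ, 0 < m ∧ (‖d.χ i t‖ = 1 → d.χ i t ^ m = 1) := by
      intro i
      by_cases hi : ‖d.χ i t‖ = 1
      · obtain ⟨m, hm, h⟩ := htor t _ (d.hasEigenvalue i t) hi
        exact ⟨m, hm, fun _ => h⟩
      · exact ⟨1, one_pos, fun h => absurd h hi⟩
    choose m hm h using h
    refine ⟨∏ i, m i, Finset.prod_pos fun i _ => hm i, fun i hi => ?_⟩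
    obtain ⟨r, hr⟩ := Finset.dvd_prod_of_mem m (Finset.mem_univ i)
    rw [hr, pow_mul, h i hi, one_pow]
  have hunim : ∀ i, ‖d.χ i t‖ = 1 → ∀ y, ‖d.χ i y‖ = 1 := by
    intro i hi y
    obtain ⟨b, rfl⟩ := exists_zpow_ofAdd_one_eq y
    rw [← ht, map_zpow, norm_zpow, hi, one_zpow]
  obtain ⟨E, hE⟩ := d.exists_le_or_forall_coord_eq_zero t hρ hs hN hsN
  obtain ⟨C₁, hC₁, hshort⟩ := d.exists_wordLength_le_hyperbolic hgen t hρ hs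
  obtain ⟨D₀, hD₀⟩ := d.exists_uniform_kernel_projection
  have hD₀0 : (0 : ℝ) ≤ D₀ := by
    obtain ⟨D, -, hD, hle, -⟩ := hD₀ 1
    exact_mod_cast hD.le.trans hle
  obtain ⟨Ci, hCi0, hCi⟩ : ∃ Ci : ℝ, 0 ≤ Ci ∧ ∀ q : ℤ, q ≠ 0 → ∀ i,
      ‖(d.χ i t ^ q - 1)⁻¹‖ ≤ Ci := by
    choose f hf0 hf using fun i =>
      exists_norm_inv_zpow_sub_one_le (d.χ_ne_zero i t) hN (hsN i)
    exact ⟨∑ i, f i, Finset.sum_nonneg fun i _ => hf0 i, fun q hq i =>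
      (hf i q hq).trans (Finset.single_le_sum (fun i _ => hf0 i) (Finset.mem_univ i))⟩
  obtain ⟨a, ha⟩ := pow_unbounded_of_one_lt (K ^ 2) hρ
  obtain ⟨a₂, ha₂⟩ := pow_unbounded_of_one_lt (∑ i, ‖d.χ i t‖) hρ
  obtain ⟨a₃, ha₃⟩ := pow_unbounded_of_one_lt (2 * Ci) hρ
  have hχ : ∀ i, ‖d.χ i t‖ ≤ ρ ^ a₂ := fun i =>
    (Finset.single_le_sum (f := fun i => ‖d.χ i t‖) (fun i _ => norm_nonneg _)
      (Finset.mem_univ i)).trans ha₂.le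
  have hβ := d.bound_pos
  set κ := ⌈K⌉₊ with hκ
  -- `B₁` serves for conjugate elements of `ℤⁿ`, and `B₂` for the others.
  set B₁ : ℝ := C * (2 * a + E + N) with hB₁
  set B₂ : ℝ := C₁ * ((a₂ * κ + a + a₃ : ℕ) + 1 + (Ci * (2 * K) + d.bound * D₀)) + C * κ with hB₂
  have hB₁0 : 0 ≤ B₁ := by positivity
  have hB₂0 : 0 ≤ B₂ := by positivity
  refine ⟨B₁ + B₂ + 1, by positivity, fun g h hgh => ?_⟩
  by_cases hL : wordLength S g + wordLength S h = 0
  · refine ⟨1, ?_, by rw [wordLength_one, Nat.cast_zero]; positivity⟩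
    rw [eq_one_of_wordLength_eq_zero hgen (Nat.add_eq_zero_iff.1 hL).1,
      eq_one_of_wordLength_eq_zero hgen (Nat.add_eq_zero_iff.1 hL).2]
  obtain ⟨u, w, x₀, v, y, rfl, rfl, hconj⟩ := exists_latticeElt_of_isConj hgh
  set L := wordLength S (latticeElt φ u v) + wordLength S (latticeElt φ w v) with hLdef
  have hLcast : (wordLength S (latticeElt φ u v) : ℝ) + wordLength S (latticeElt φ w v) = L := by
    rw [hLdef, Nat.cast_add]
  rw [hLcast]
  have hL1 : (1 : ℝ) ≤ L := by exact_mod_cast Nat.one_le_iff_ne_zero.2 hL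
  have hexp : ∀ m ≤ L, K ^ (2 * m) ≤ ρ ^ (a * L) := fun m hm => by
    calc K ^ (2 * m) ≤ K ^ (2 * L) := pow_le_pow_right₀ (by linarith) (by omega)
      _ = (K ^ 2) ^ L := pow_mul _ _ _
      _ ≤ (ρ ^ a) ^ L := by gcongr
      _ = _ := (pow_mul _ _ _).symm
  have hcu : ∀ i, ‖d.intCoord u i‖ ≤ ρ ^ (a * L) := fun i =>
    ((hK u v).2 i).2.1.trans (hexp _ (by omega))
  have hcw : ∀ i, ‖d.intCoord w i‖ ≤ ρ ^ (a * L) := fun i =>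
    ((hK w v).2 i).2.1.trans (hexp _ (by omega))
  obtain ⟨b, rfl⟩ := exists_zpow_ofAdd_one_eq y
  obtain ⟨q, hq⟩ := exists_zpow_ofAdd_one_eq v
  rw [← ht] at hconj hq
  have hχb : ∀ i (b : ℤ), d.χ i (t ^ b) = d.χ i t ^ b := fun i b => map_zpow _ _ _
  by_cases hq0 : q = 0
  · have hv : v = 1 := by rw [hq, hq0, zpow_zero]
    have huw : u = (φ (t ^ b)).1.mulVec w := by
      rw [hv, one_mulVec, add_comm] at hconj
      exact add_left_cancel hconj
    have hcuw : ∀ i, d.intCoord u i = d.χ i t ^ b * d.intCoord w i := fun i => by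
      rw [huw, d.intCoord_mulVec, hχb]
    have hb : |b| ≤ 2 * (a * L) + E ∨ ∀ i, ‖d.χ i t‖ ≠ 1 → d.intCoord w i = 0 := by
      obtain ⟨m, rfl | rfl⟩ := b.eq_nat_or_neg
      · rw [zpow_natCast] at huw
        refine (hE m (a * L) u w huw hcu hcw).imp_left fun h => ?_
        rw [Nat.abs_cast]
        exact_mod_cast h
      · have hwu : w = (φ (t ^ m)).1.mulVec u := by
          rw [huw, ← mulVec_mul, zpow_neg, zpow_natCast, mul_inv_cancel, one_mulVec]
        refine (hE m (a * L) w u hwu hcw hcu).imp (fun h => ?_) fun h i hi => ?_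
        · rw [abs_neg, Nat.abs_cast]
          exact_mod_cast h
        · have := h i hi
          rw [hcuw] at this
          exact (mul_eq_zero.1 this).resolve_left (zpow_ne_zero _ (d.χ_ne_zero i t))
    -- If only unimodular eigenvectors occur in `w`, then `φ t ^ N` fixes `w`.
    obtain ⟨b', hb', hub'⟩ : ∃ b' : ℤ, |b'| ≤ 2 * (a * L) + E + N ∧
        u = (φ (t ^ b')).1.mulVec w := by
      rcases hb with hb | hb
      · exact ⟨b, by omega, huw⟩
      · have hN' : (0 : ℤ) < N := by exact_mod_cast hN
        refine ⟨b % N, ?_, d.intCoord_injective ?_⟩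
        · rw [abs_of_nonneg (Int.emod_nonneg _ hN'.ne')]
          have := Int.emod_lt_of_pos b hN'
          have : (0 : ℤ) ≤ 2 * (a * L) + E := by positivity
          omega
        · ext i
          rw [hcuw, d.intCoord_mulVec, hχb]
          by_cases hi : ‖d.χ i t‖ = 1
          · rw [zpow_emod_of_pow_eq_one (d.χ_ne_zero i t) (hsN i hi)]
          · rw [hb i hi, mul_zero, mul_zero]
    refine ⟨latticeElt φ 0 (t ^ b'), latticeElt_conj_iff.2 ?_, ?_⟩
    · rw [Matrix.mulVec_zero, add_zero, zero_add]
      exact hub'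
    have h₁ := hCy 0 (t ^ b')
    have h₂ := hCx 0
    rw [norm_zero, mul_zero] at h₂
    rw [norm_toAdd_ofAdd_one_zpow] at h₁
    have h₃ : |(b' : ℝ)| ≤ 2 * (a * L) + E + N := by exact_mod_cast hb'
    have h₄ : C * |(b' : ℝ)| ≤ B₁ * L := by
      rw [hB₁, mul_assoc]
      gcongr
      have e₁ : (E : ℝ) ≤ E * L := le_mul_of_one_le_right (by positivity) hL1
      have e₂ : (N : ℝ) ≤ N * L := le_mul_of_one_le_right (by positivity) hL1
      linarith
    have h₅ : 0 ≤ (B₂ + 1) * L := by positivity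
    linarith
  · -- Multiplying the conjugator by powers of `(u, v)` replaces `b` by its remainder modulo `q`.
    set r := (b % q).toNat with hr
    have hr0 : ((r : ℕ) : ℤ) = b % q := Int.toNat_of_nonneg (Int.emod_nonneg _ hq0)
    have hrκ : r ≤ κ * L := by
      have h₁ := (hK u v).1
      rw [hq, norm_toAdd_ofAdd_one_zpow, ← hq] at h₁
      have h₂ : ((r : ℕ) : ℝ) ≤ |(q : ℝ)| := by
        have := (Int.emod_lt_abs b hq0).le
        rw [← hr0] at this
        exact_mod_cast this
      have h₃ : K * wordLength S (latticeElt φ u v) ≤ κ * L := by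
        gcongr
        · exact Nat.le_ceil K
        · omega
      exact_mod_cast h₂.trans (h₁.trans h₃)
    obtain ⟨x₁, hx₁⟩ : ∃ x₁, u + (φ v).1.mulVec x₁ = x₁ + (φ (t ^ r)).1.mulVec w := by
      obtain ⟨x₁, y₁, hxy⟩ := exists_eq_latticeElt
        ((latticeElt φ u v) ^ (-(b / q)) * latticeElt φ x₀ (t ^ b))
      have hy₁ : y₁ = t ^ r := by
        have := congrArg (SemidirectProduct.rightHom : LatticeSemidirect φ →* _) hxy
        rw [map_mul, map_zpow] at this
        change v ^ (-(b / q)) * t ^ b = y₁ at this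
        rw [← this, hq, ← zpow_mul, ← zpow_add, ← zpow_natCast, hr0, Int.emod_def]
        congr 1
        ring
      refine ⟨x₁, latticeElt_conj_iff.1 ?_⟩
      rw [← hy₁, ← hxy, ← mul_assoc, ← zpow_one_add, add_comm, zpow_add_one, mul_assoc, mul_assoc,
        latticeElt_conj_iff.2 hconj]
    obtain ⟨D, P, hD, hDle, hP⟩ := hD₀ v
    obtain ⟨x, hx, hxc⟩ := d.exists_small_solution hD hP x₁
    have hx' : (φ v).1.mulVec x₁ - x₁ = (φ (t ^ r)).1.mulVec w - u := by
      rw [sub_eq_sub_iff_add_eq_add, add_comm, hx₁, add_comm]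
    have hcoord : ∀ i, d.χ i v ≠ 1 → ‖d.intCoord x i‖ ≤
        Ci * (‖d.χ i t‖ ^ r * ‖d.intCoord w i‖ + ‖d.intCoord u i‖) := by
      intro i hi
      have h₁ := d.coord_eq_of_mulVec_sub hx' i
      rw [(hxc i).1 hi, ← inv_mul_cancel_left₀ (sub_ne_zero.2 hi) (d.intCoord x₁ i), h₁, norm_mul]
      have h₂ : ‖(d.χ i v - 1)⁻¹‖ ≤ Ci := by
        rw [hq, hχb]
        exact hCi q hq0 i
      refine mul_le_mul h₂ ?_ (norm_nonneg _) hCi0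
      rw [map_sub, Pi.sub_apply, d.intCoord_mulVec, map_pow, ← norm_pow, ← norm_mul]
      exact norm_sub_le _ _
    set M : ℝ := (Ci * (2 * K) + d.bound * D₀) * L with hM
    have hlen := hshort x ((a₂ * κ + a + a₃) * L) M (by positivity) (fun i hi => ?_) fun i hi => ?_
    · refine ⟨latticeElt φ x (t ^ r), latticeElt_conj_iff.2 ?_, ?_⟩
      · rw [hx', sub_eq_sub_iff_add_eq_add] at hx
        rw [add_comm, hx, add_comm]
      · refine (hCy x (t ^ r)).trans ?_
        rw [← zpow_natCast t r, norm_toAdd_ofAdd_one_zpow, Int.cast_natCast, Nat.abs_cast]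
        have h₁ : C * (r : ℝ) ≤ C * κ * L := by
          rw [mul_assoc]
          gcongr
          exact_mod_cast hrκ
        have h₂ : C₁ * ((((a₂ * κ + a + a₃) * L : ℕ) : ℝ) + 1 + M) ≤
            C₁ * ((a₂ * κ + a + a₃ : ℕ) + 1 + (Ci * (2 * K) + d.bound * D₀)) * L := by
          rw [mul_assoc]
          refine mul_le_mul_of_nonneg_left ?_ hC₁
          rw [hM, Nat.cast_mul _ L]
          linarith
        have h₃ : 0 ≤ (B₁ + 1) * L := by positivity
        have h₄ : B₂ * L = C₁ * ((a₂ * κ + a + a₃ : ℕ) + 1 + (Ci * (2 * K) + d.bound * D₀)) * L +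
            C * κ * L := by rw [hB₂, add_mul]
        linarith
    · have hv1 : d.χ i v ≠ 1 := fun h' => by
        rw [hq, hχb] at h'
        have := congrArg norm h'
        rw [norm_zpow, norm_one] at this
        exact absurd ((zpow_eq_one_iff_right₀ (norm_nonneg _) hi).1 this) hq0
      refine (hcoord i hv1).trans ?_
      have h₁ : ‖d.χ i t‖ ^ r ≤ ρ ^ (a₂ * κ * L) := by
        calc ‖d.χ i t‖ ^ r ≤ (ρ ^ a₂) ^ r := pow_le_pow_left₀ (norm_nonneg _) (hχ i) r
          _ = ρ ^ (a₂ * r) := (pow_mul _ _ _).symm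
          _ ≤ _ := pow_le_pow_right₀ hρ.le (by rw [mul_assoc]; exact Nat.mul_le_mul_left _ hrκ)
      have h₂ : 2 * Ci ≤ ρ ^ (a₃ * L) := ha₃.le.trans
        (pow_le_pow_right₀ hρ.le (Nat.le_mul_of_pos_right _ (Nat.pos_of_ne_zero hL)))
      have h₃ : (1 : ℝ) ≤ ρ ^ (a₂ * κ * L) := one_le_pow₀ hρ.le
      calc Ci * (‖d.χ i t‖ ^ r * ‖d.intCoord w i‖ + ‖d.intCoord u i‖)
          ≤ Ci * (ρ ^ (a₂ * κ * L) * ρ ^ (a * L) + ρ ^ (a₂ * κ * L) * ρ ^ (a * L)) := by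
            gcongr
            · exact hcw i
            · exact (hcu i).trans (le_mul_of_one_le_left (by positivity) h₃)
        _ = 2 * Ci * (ρ ^ (a₂ * κ * L) * ρ ^ (a * L)) := by ring
        _ ≤ ρ ^ (a₃ * L) * (ρ ^ (a₂ * κ * L) * ρ ^ (a * L)) := by gcongr
        _ = _ := by rw [← pow_add, ← pow_add]; congr 1; ring
    · by_cases hv1 : d.χ i v = 1
      · calc ‖d.intCoord x i‖ ≤ d.bound * D := (hxc i).2 hv1
          _ ≤ d.bound * D₀ := by gcongr
          _ ≤ d.bound * D₀ * L := le_mul_of_one_le_right (by positivity) hL1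
          _ ≤ M := by
            rw [hM, add_mul]
            exact le_add_of_nonneg_left (by positivity)
      · refine (hcoord i hv1).trans ?_
        have h₁ := ((hK u v).2 i).2.2 (hunim i hi)
        have h₂ := ((hK w v).2 i).2.2 (hunim i hi)
        rw [hi, one_pow, one_mul]
        calc Ci * (‖d.intCoord w i‖ + ‖d.intCoord u i‖) ≤ Ci * (K * L) := by
              gcongr
              rw [← hLcast]
              linarith
          _ ≤ Ci * (2 * K) * L := by
              have : 0 ≤ Ci * (K * L) := by positivity
              linarith
          _ ≤ M := by
            rw [hM, add_mul]
            exact le_add_of_nonneg_right (by positivity)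

end JointDiagonalization

end

theorem mainTheorem1 (n k : ℕ)
    (φ : Multiplicative (Fin k → ℤ) →* Matrix.SpecialLinearGroup (Fin n) ℤ)
    (hφ : Function.Injective φ)
    (hss : ∀ v : Multiplicative (Fin k → ℤ), IsSemisimpleSL (φ v))
    (S : Set (LatticeSemidirect φ)) (hfin : S.Finite) (hgen : Subgroup.closure S = ⊤) :
    ∃ A B : ℝ, 0 < A ∧ 0 < B ∧
      ∀ g h : LatticeSemidirect φ, IsConj g h →
        ∃ c : LatticeSemidirect φ, g * c = c * h ∧
          (k = 1 → (∀ v : Multiplicative (Fin k → ℤ), UnimodularEigenvaluesTorsion (φ v)) →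
            (wordLength S c : ℝ) ≤ B * ((wordLength S g : ℝ) + (wordLength S h : ℝ))) ∧
          (1 < k →
            (wordLength S c : ℝ) ≤ A ^ (wordLength S g + wordLength S h)) := by
  obtain ⟨d⟩ := JointDiagonalization.nonempty hss
  by_cases hk : k = 1 ∧ ∀ v, UnimodularEigenvaluesTorsion (φ v)
  · obtain ⟨rfl, htor⟩ := hk
    obtain ⟨B, hB, h⟩ := d.exists_conj_wordLength_le_mul hfin hgen htor
    refine ⟨1, B, one_pos, hB, fun g g' hg => ?_⟩
    obtain ⟨c, hc, hl⟩ := h g g' hg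
    exact ⟨c, hc, fun _ _ => hl, fun h => absurd h (lt_irrefl 1)⟩
  · obtain ⟨A, hA, h⟩ := d.exists_conj_wordLength_le_pow hfin hgen
    refine ⟨A, 1, hA, one_pos, fun g g' hg => ?_⟩
    obtain ⟨c, hc, hl⟩ := h g g' hg
    exact ⟨c, hc, fun h₁ h₂ => absurd ⟨h₁, h₂⟩ hk, fun _ => hl⟩
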